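/- Let $X$ be a countable (finite or infinite) set and let $k(x,y)$, $x,y\in X$, be the transition rates of an irreducible continuous-time Markov chain on $X$: $k(x,y)\ge 0$ for $x\ne y$, $\sum_{y\in X}k(x,y)=0$, and for every $x\in X$ $$M_1(x)=\sum_{y\ne x}k(x,y)<\infty,\qquad M_2(x)=\sum_{y\ne x}k(x,y)\sum_{z\ne y}k(y,z)<\infty .$$ Let $Lf(x)=\sum_{y}k(x,y)(f(y)-f(x))$ be the generator. Let $\mu$ be a probability measure on $X$ satisfying the detailed balance condition $\mu(\{x\})k(x,y)=\mu(\{y\})k(y,x)$ for all $x,y\in X$. Let $\Upsilon(r)=e^r-r-1$ and, for a differentiable function $H:\mathbb R\to\mathbb R$, $$\Psi_H(f)(x)=\sum_{y}k(x,y)H(f(y)-f(x)),\qquad B_H(f,g)(x)=\sum_y k(x,y)H(f(y)-f(x))(g(y)-g(x)),$$ $$\Psi_{2,H}(f)=\tfrac12\big(L\Psi_H(f)-B_{H'}(f,Lf)\big).$$ For $\kappa\in\mathbb R$ and $n\in(0,\infty)$, say that $L$ satisfies $CD_\Upsilon(\kappa,n)$ if for every bounded $f:X\to\mathbb R$ and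 every $x\in X$ $$\Psi_{2,\Upsilon}(f)(x)\ge \kappa\,\Psi_\Upsilon(f)(x)+\tfrac1n\big(\max\{-Lf(x),0\}\big)^2 .$$ For $g:X\to(0,\infty)$ let $$\mathcal I(g)=\tfrac12\sum_{x,y\in X}k(x,y)\big(g(y)-g(x)\big)\big(\log g(y)-\log g(x)\big)\mu(\{x\})\in[0,\infty]$$ be the Fisher information, and let $\|\cdot\|_p$ denote the norm of $\ell^p(\mu)$. Suppose that $M_1\in\ell^2(\mu)$, $M_2\in\ell^1(\mu)$, that the Markov chain generated by $L$ is positive recurrent, and that $L$ satisfies $CD_\Upsilon(\kappa,n)$ for some $\kappa>0$ and $n\in(0,\infty)$. Then $$\|f\|_2^{\,n+2}\le\Big(\|f\|_2^2+\frac{\mathcal I(f^2)}{\kappa n}\Big)^{n/2}\|f\|_1^2$$ for every $f\in\ell^2(\mu)$ with $f(x)\ne0$ for all $x\in X$ (if $\mathcal I(f^2)=\infty$ the right-hand side is $\infty$). -/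

import Mathlib

open MeasureTheory ProbabilityTheory
open scoped ENNReal

/-- Transition rates `k(x,y)` of a continuous-time Markov chain on `X`: the off-diagonal rates are
non-negative, the exit rates `M₁(x) = ∑_{y ≠ x} k(x,y)` are finite, `∑_y k(x,y) = 0`
(so `k(x,x) = -M₁(x)`), and `M₂(x) = ∑_{y ≠ x} k(x,y) ∑_{z ≠ y} k(y,z)` is finite. -/
structure MarkovRates (X : Type*) where
  /-- the rates `k(x,y)` -/
  rate : X → X → ℝ
  rate_nonneg : ∀ x y, x ≠ y → 0 ≤ rate x y
  rate_hasSum : ∀ x, HasSum (rate x) 0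
  summable_M₂ : ∀ x, Summable fun y : {y : X // y ≠ x} =>
    rate x y * ∑' z : {z : X // z ≠ y.1}, rate y z

namespace MarkovRates

noncomputable section

variable {X : Type*}

/-- The exit rate `M₁(x) = ∑_{y ≠ x} k(x,y)`. -/
def M₁ (k : MarkovRates X) (x : X) : ℝ :=
  ∑' y : {y : X // y ≠ x}, k.rate x y

/-- `M₂(x) = ∑_{y ≠ x} k(x,y) ∑_{z ≠ y} k(y,z)`. -/
def M₂ (k : MarkovRates X) (x : X) : ℝ :=
  ∑' y : {y : X // y ≠ x}, k.rate x y * k.M₁ y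

/-- Irreducibility: any two states are joined by a path of positive jump rates. -/
def Irreducible (k : MarkovRates X) : Prop :=
  ∀ x y, Relation.ReflTransGen (fun a b => a ≠ b ∧ 0 < k.rate a b) x y

/-! ### The generator and the curvature-dimension condition -/

/-- The generator `L f(x) = ∑_y k(x,y) (f(y) - f(x))`. -/
def gen (k : MarkovRates X) (f : X → ℝ) (x : X) : ℝ :=
  ∑' y, k.rate x y * (f y - f x)

/-- `Ψ_H(f)(x) = ∑_y k(x,y) H(f(y) - f(x))`. -/
def Psi (k : MarkovRates X) (H : ℝ → ℝ) (f : X → ℝ) (x : X) : ℝ :=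
  ∑' y, k.rate x y * H (f y - f x)

/-- `B_H(f,g)(x) = ∑_y k(x,y) H(f(y) - f(x)) (g(y) - g(x))`. -/
def B (k : MarkovRates X) (H : ℝ → ℝ) (f g : X → ℝ) (x : X) : ℝ :=
  ∑' y, k.rate x y * H (f y - f x) * (g y - g x)

/-- `Ψ_{2,H}(f) = ½ (L Ψ_H(f) - B_{H'}(f, L f))`. -/
def Psi₂ (k : MarkovRates X) (H : ℝ → ℝ) (f : X → ℝ) (x : X) : ℝ :=
  (k.gen (k.Psi H f) x - k.B (deriv H) f (k.gen f) x) / 2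

/-- `Υ(r) = e^r - r - 1`. -/
def Upsilon (r : ℝ) : ℝ := Real.exp r - r - 1

/-- The extension by zero to the negative half-line of a function given on `[0,∞)`. -/
def trivialExtension (F : ℝ → ℝ) (r : ℝ) : ℝ :=
  open Classical in if 0 ≤ r then F r else 0

/-- The condition `CD_Υ(κ,F)`: `Ψ_{2,Υ}(f) ≥ κ Ψ_Υ(f) + F₀(-L f)` on `X` for all bounded `f`.
Only the values of `F` on `[0,∞)` matter. -/
def CDUpsilonFun (k : MarkovRates X) (κ : ℝ) (F : ℝ → ℝ) : Prop :=
  ∀ f : X → ℝ, (∃ C, ∀ x, |f x| ≤ C) → ∀ x,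
    k.Psi₂ Upsilon f x ≥ κ * k.Psi Upsilon f x + trivialExtension F (-k.gen f x)

/-- The condition `CD_Υ(κ,n)`, i.e. `CD_Υ(κ,F)` with `F(r) = r²/n`. -/
def CDUpsilon (k : MarkovRates X) (κ n : ℝ) : Prop :=
  k.CDUpsilonFun κ fun r => r ^ 2 / n

/-! ### The Markov chain and positive recurrence

The chain generated by the rates (minimal in case of explosion) is described by its jump chain
`Y₀, Y₁, …` and independent standard exponential clocks `E₀, E₁, …`: it stays in `Y_j` for the
time `E_j / M₁(Y_j)` and then jumps to `Y_{j+1}`. -/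

/-- The weights `k(x,y)`, `y ≠ x`, of the possible jumps out of `x`. -/
def jumpWeight (k : MarkovRates X) (x y : X) : ℝ≥0∞ :=
  Set.indicator {x}ᶜ (fun y => ENNReal.ofReal (k.rate x y)) y

theorem tsum_jumpWeight_ne_top (k : MarkovRates X) (x : X) : ∑' y, k.jumpWeight x y ≠ ∞ := by
  have h : ∀ y, k.jumpWeight x y ≤ ENNReal.ofReal (k.rate x y) := fun y =>
    Set.indicator_le_self' (fun _ _ => zero_le) y
  exact ne_top_of_le_ne_top (k.rate_hasSum x).summable.tsum_ofReal_ne_top (ENNReal.tsum_le_tsum h)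

/-- The distribution of the next state after a jump out of `x`: it is `y ≠ x` with probability
`k(x,y) / M₁(x)`. An absorbing state is never left. -/
def jumpPMF (k : MarkovRates X) (x : X) : PMF X :=
  open Classical in
  if h : ∑' y, k.jumpWeight x y = 0 then PMF.pure x
  else PMF.normalize (k.jumpWeight x) h (k.tsum_jumpWeight_ne_top x)

section Chain

variable [Countable X] [MeasurableSpace X] [MeasurableSingletonClass X]

/-- The transition kernel of the jump chain. -/
def jumpKernel (k : MarkovRates X) : Kernel X X :=
  Kernel.ofFunOfCountable fun x => (k.jumpPMF x).toMeasure

instance (k : MarkovRates X) : IsMarkovKernel k.jumpKernel :=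
  ⟨fun x => inferInstanceAs (IsProbabilityMeasure (k.jumpPMF x).toMeasure)⟩

/-- The law of the jump chain `(Y_j)` started in `x`. -/
def jumpChainLaw (k : MarkovRates X) (x : X) : Measure (ℕ → X) :=
  Kernel.trajMeasure (X := fun _ => X) (Measure.dirac x) fun n =>
    k.jumpKernel.comap (fun h : (i : Finset.Iic n) → X => h ⟨n, Finset.mem_Iic.2 le_rfl⟩)
      (measurable_pi_apply _)

/-- The joint law of the jump chain `(Y_j)` started in `x` and the clocks `(E_j)`. -/
def chainLaw (k : MarkovRates X) (x : X) : Measure ((ℕ → X) × (ℕ → ℝ)) :=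
  (k.jumpChainLaw x).prod (Measure.infinitePi fun _ => expMeasure 1)

/-- The time `E_j / M₁(Y_j)` spent in the state `Y_j`; it is infinite if `Y_j` is absorbing. -/
def holdingTime (k : MarkovRates X) (ω : (ℕ → X) × (ℕ → ℝ)) (j : ℕ) : ℝ≥0∞ :=
  ENNReal.ofReal (ω.2 j) / ENNReal.ofReal (k.M₁ (ω.1 j))

/-- The time of the first return to `x`, i.e. the first time after the first jump at which the
chain is in `x`; it is infinite if there is no return. -/
def returnTime (k : MarkovRates X) (x : X) (ω : (ℕ → X) × (ℕ → ℝ)) : ℝ≥0∞ :=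
  ⨅ (n : ℕ) (_ : 1 ≤ n ∧ ω.1 n = x), ∑ j ∈ Finset.range n, k.holdingTime ω j

/-- Positive recurrence: every state is absorbing or has finite expected return time. -/
def PositiveRecurrent (k : MarkovRates X) : Prop :=
  ∀ x, k.M₁ x = 0 ∨ ∫⁻ ω, k.returnTime x ω ∂(k.chainLaw x) < ∞

end Chain

/-! ### Reversibility and the Fisher information -/

/-- Detailed balance: `μ({x}) k(x,y) = μ({y}) k(y,x)`. -/
def DetailedBalance [MeasurableSpace X] (k : MarkovRates X) (μ : Measure X) : Prop :=
  ∀ x y, μ.real {x} * k.rate x y = μ.real {y} * k.rate y x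

/-- The Fisher information
`I(f) = ½ ∑_{x,y} k(x,y) (f(y) - f(x)) (log f(y) - log f(x)) μ({x}) ∈ [0,∞]` of a positive
function `f`; all summands are non-negative. -/
def fisherInformation [MeasurableSpace X] (k : MarkovRates X) (μ : Measure X) (f : X → ℝ) :
    ℝ≥0∞ :=
  2⁻¹ * ∑' (x : X) (y : X), ENNReal.ofReal
    (k.rate x y * (f y - f x) * (Real.log (f y) - Real.log (f x)) * μ.real {x})

end

end MarkovRates

/-! For `‖f‖₂ = 1`, Jensen's inequality gives `-2 log ‖f‖₁ ≤ H(f²)`, where `H(g) = ∑ m g log g`. The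
Nash inequality is thus the exponential form of the entropy-information inequality `H(g) ≤ (n/2) log
(1 + I(g)/(κn))` for densities `g`.

That inequality comes from the heat flow. Along it `H' = -I`. Integrating the curvature condition
for `log g` against `g m` and using Jensen for the square gives `I' ≤ -2κI - 2I²/n`. Hence `I ≤
-(d/dt) (n/2) log (1 + I/(κn))`, and integration up to infinite time, where `H` and `I` vanish,
gives the claim.

The flow is discretised by implicit Euler steps `g - h L g = f`, which need no time derivatives.
Convexity turns the two differential relations into one-step inequalities (`fisher_step`,
`entropy_step`). The quadratic error of the entropy step is summed with the help of the Dirichlet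
energy (`energy_step`), so the total error is of order `h` (`entropy_le_add`) and disappears as `h →
0` (`entropy_le`).

All this is done for densities between two positive constants, where integration by parts needs only
that `M₁` is square summable. Truncation does not increase the Fisher information, so the general
case follows by a limit (`nash`). -/

namespace MarkovRates

noncomputable section

variable {X : Type*}

/-! ### Off-diagonal rates -/

/-- The off-diagonal part of the rates. -/
def jumpRate (k : MarkovRates X) (x y : X) : ℝ :=
  open Classical in if x = y then 0 else k.rate x y

theorem jumpRate_nonneg (k : MarkovRates X) (x y : X) : 0 ≤ k.jumpRate x y := by
  unfold jumpRate
  split_ifs with h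
  · exact le_rfl
  · exact k.rate_nonneg x y h

theorem rate_mul_eq_jumpRate_mul (k : MarkovRates X) {x y : X} {r : ℝ} (h : x = y → r = 0) :
    k.rate x y * r = k.jumpRate x y * r := by
  unfold jumpRate
  split_ifs with hxy
  · simp [h hxy]
  · rfl

theorem jumpRate_eq_indicator (k : MarkovRates X) (x : X) :
    k.jumpRate x = Set.indicator {y | y ≠ x} (k.rate x) := by
  classical
  ext y
  by_cases h : x = y
  · simp [jumpRate, h]
  · simp [jumpRate, h, Ne.symm h]

theorem summable_jumpRate (k : MarkovRates X) (x : X) : Summable (k.jumpRate x) := by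
  rw [jumpRate_eq_indicator]
  exact (k.rate_hasSum x).summable.indicator _

theorem tsum_jumpRate (k : MarkovRates X) (x : X) : ∑' y, k.jumpRate x y = k.M₁ x := by
  rw [M₁, jumpRate_eq_indicator]
  exact (tsum_subtype {y | y ≠ x} (k.rate x)).symm

theorem M₁_nonneg (k : MarkovRates X) (x : X) : 0 ≤ k.M₁ x := by
  rw [← tsum_jumpRate]
  exact tsum_nonneg fun y => k.jumpRate_nonneg x y

theorem summable_jumpRate_mul (k : MarkovRates X) (x : X) {v : X → ℝ} {C : ℝ}
    (hv : ∀ y, |v y| ≤ C) : Summable fun y => k.jumpRate x y * v y := by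
  refine Summable.of_norm_bounded ((k.summable_jumpRate x).mul_right C) fun y => ?_
  rw [Real.norm_eq_abs, abs_mul, abs_of_nonneg (k.jumpRate_nonneg x y)]
  exact mul_le_mul_of_nonneg_left (hv y) (k.jumpRate_nonneg x y)

theorem abs_tsum_jumpRate_mul_le (k : MarkovRates X) (x : X) {v : X → ℝ} {C : ℝ}
    (hv : ∀ y, |v y| ≤ C) : |∑' y, k.jumpRate x y * v y| ≤ C * k.M₁ x := by
  rw [← tsum_jumpRate, ← tsum_mul_left, ← Real.norm_eq_abs]
  refine tsum_of_norm_bounded ((k.summable_jumpRate x).mul_left C).hasSum fun y => ?_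
  rw [Real.norm_eq_abs, abs_mul, abs_of_nonneg (k.jumpRate_nonneg x y), mul_comm]
  exact mul_le_mul_of_nonneg_right (hv y) (k.jumpRate_nonneg x y)

theorem gen_eq (k : MarkovRates X) (f : X → ℝ) (x : X) :
    k.gen f x = ∑' y, k.jumpRate x y * (f y - f x) :=
  tsum_congr fun y => k.rate_mul_eq_jumpRate_mul fun h => by simp [h]

theorem Psi_eq (k : MarkovRates X) {H : ℝ → ℝ} (hH : H 0 = 0) (f : X → ℝ) (x : X) :
    k.Psi H f x = ∑' y, k.jumpRate x y * H (f y - f x) :=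
  tsum_congr fun y => k.rate_mul_eq_jumpRate_mul fun h => by simp [h, hH]

theorem B_eq (k : MarkovRates X) (H : ℝ → ℝ) (f g : X → ℝ) (x : X) :
    k.B H f g x = ∑' y, k.jumpRate x y * (H (f y - f x) * (g y - g x)) :=
  tsum_congr fun y => by
    rw [mul_assoc]
    exact k.rate_mul_eq_jumpRate_mul fun h => by simp [h]

theorem abs_sub_le_of_bounded {f : X → ℝ} {C : ℝ} (hf : ∀ x, |f x| ≤ C) (x y : X) :
    |f y - f x| ≤ 2 * C := by
  have := abs_sub (f y) (f x)
  linarith [hf x, hf y]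

theorem abs_gen_le (k : MarkovRates X) {f : X → ℝ} {C : ℝ} (hf : ∀ x, |f x| ≤ C) (x : X) :
    |k.gen f x| ≤ 2 * C * k.M₁ x := by
  rw [gen_eq]
  exact k.abs_tsum_jumpRate_mul_le x fun y => abs_sub_le_of_bounded hf x y

/-! ### Reversible weights and double sums -/

/-- The weights `m` of a reversible probability measure for which the exit rate is square
summable. -/
structure IsReversible (k : MarkovRates X) (m : X → ℝ) : Prop where
  nonneg : ∀ x, 0 ≤ m x
  hasSum : HasSum m 1
  symm : ∀ x y, m x * k.rate x y = m y * k.rate y x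
  summable_sq : Summable fun x => m x * k.M₁ x ^ 2

/-- The conductance `m(x) k(x,y)` of the edge `p = (x,y)`. -/
def conductance (k : MarkovRates X) (m : X → ℝ) (p : X × X) : ℝ :=
  m p.1 * k.jumpRate p.1 p.2

/-- A function on pairs of states that grows at most linearly in the exit rates. -/
def RateGrowth (k : MarkovRates X) (v : X × X → ℝ) : Prop :=
  ∃ C, ∀ p, |v p| ≤ C * (1 + k.M₁ p.1 + k.M₁ p.2)

/-- A function on states that grows at most linearly in the exit rate. -/
def PointGrowth (k : MarkovRates X) (u : X → ℝ) : Prop :=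
  ∃ C, ∀ x, |u x| ≤ C * (1 + k.M₁ x)

/-- The sum of `v` over all edges weighted by conductances. -/
def edgeSum (k : MarkovRates X) (m : X → ℝ) (v : X × X → ℝ) : ℝ :=
  ∑' p, k.conductance m p * v p

variable {k : MarkovRates X} {m : X → ℝ}

theorem RateGrowth.exists_nonneg {v : X × X → ℝ} (hv : k.RateGrowth v) :
    ∃ C, 0 ≤ C ∧ ∀ p, |v p| ≤ C * (1 + k.M₁ p.1 + k.M₁ p.2) := by
  obtain ⟨C, hC⟩ := hv
  refine ⟨max C 0, le_max_right _ _, fun p => (hC p).trans ?_⟩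
  have h₁ := k.M₁_nonneg p.1
  have h₂ := k.M₁_nonneg p.2
  exact mul_le_mul_of_nonneg_right (le_max_left _ _) (by linarith)

theorem PointGrowth.exists_nonneg {u : X → ℝ} (hu : k.PointGrowth u) :
    ∃ C, 0 ≤ C ∧ ∀ x, |u x| ≤ C * (1 + k.M₁ x) := by
  obtain ⟨C, hC⟩ := hu
  refine ⟨max C 0, le_max_right _ _, fun x => (hC x).trans ?_⟩
  have h₁ := k.M₁_nonneg x
  exact mul_le_mul_of_nonneg_right (le_max_left _ _) (by linarith)

theorem RateGrowth.add {v w : X × X → ℝ} (hv : k.RateGrowth v) (hw : k.RateGrowth w) :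
    k.RateGrowth fun p => v p + w p := by
  obtain ⟨C, hC⟩ := hv
  obtain ⟨D, hD⟩ := hw
  exact ⟨C + D, fun p => (abs_add_le _ _).trans (by linarith [hC p, hD p])⟩

theorem RateGrowth.const_mul {v : X × X → ℝ} (hv : k.RateGrowth v) (r : ℝ) :
    k.RateGrowth fun p => r * v p := by
  obtain ⟨C, hC⟩ := hv
  refine ⟨|r| * C, fun p => ?_⟩
  rw [abs_mul, mul_assoc]
  exact mul_le_mul_of_nonneg_left (hC p) (abs_nonneg r)

theorem RateGrowth.bounded_mul {v w : X × X → ℝ} {C : ℝ} (hw : ∀ p, |w p| ≤ C)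
    (hv : k.RateGrowth v) : k.RateGrowth fun p => w p * v p := by
  obtain ⟨D, h0, hD⟩ := hv.exists_nonneg
  refine ⟨C * D, fun p => ?_⟩
  rw [abs_mul, mul_assoc]
  exact mul_le_mul (hw p) (hD p) (abs_nonneg _) ((abs_nonneg _).trans (hw p))

theorem RateGrowth.sub {v w : X × X → ℝ} (hv : k.RateGrowth v) (hw : k.RateGrowth w) :
    k.RateGrowth fun p => v p - w p := by
  simpa [sub_eq_add_neg] using hv.add (hw.const_mul (-1))

theorem RateGrowth.swap {v : X × X → ℝ} (hv : k.RateGrowth v) :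
    k.RateGrowth fun p => v p.swap := by
  obtain ⟨C, hC⟩ := hv
  refine ⟨C, fun p => (hC p.swap).trans_eq ?_⟩
  simp only [Prod.fst_swap, Prod.snd_swap]
  ring

theorem rateGrowth_of_bounded {v : X × X → ℝ} {C : ℝ} (hv : ∀ p, |v p| ≤ C) :
    k.RateGrowth v := by
  refine ⟨C, fun p => (hv p).trans ?_⟩
  have h₁ := k.M₁_nonneg p.1
  have h₂ := k.M₁_nonneg p.2
  have h₃ := (abs_nonneg _).trans (hv p)
  nlinarith [mul_nonneg h₃ h₁, mul_nonneg h₃ h₂]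

theorem PointGrowth.fst {u : X → ℝ} (hu : k.PointGrowth u) : k.RateGrowth fun p => u p.1 := by
  obtain ⟨C, h0, hC⟩ := hu.exists_nonneg
  refine ⟨C, fun p => (hC p.1).trans ?_⟩
  have h₂ := k.M₁_nonneg p.2
  nlinarith [mul_nonneg h0 h₂]

theorem PointGrowth.snd {u : X → ℝ} (hu : k.PointGrowth u) : k.RateGrowth fun p => u p.2 :=
  hu.fst.swap

theorem pointGrowth_of_bounded {u : X → ℝ} {C : ℝ} (hu : ∀ x, |u x| ≤ C) :
    k.PointGrowth u := by
  refine ⟨C, fun x => (hu x).trans ?_⟩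
  nlinarith [mul_nonneg ((abs_nonneg _).trans (hu x)) (k.M₁_nonneg x)]

theorem pointGrowth_of_le_M₁ {u : X → ℝ} {C : ℝ} (hu : ∀ x, |u x| ≤ C * k.M₁ x) :
    k.PointGrowth u := by
  refine ⟨|C|, fun x => (hu x).trans ?_⟩
  nlinarith [mul_le_mul_of_nonneg_right (le_abs_self C) (k.M₁_nonneg x), abs_nonneg C]

theorem pointGrowth_gen {f : X → ℝ} {C : ℝ} (hf : ∀ x, |f x| ≤ C) : k.PointGrowth (k.gen f) :=
  pointGrowth_of_le_M₁ (k.abs_gen_le hf)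

theorem edgeSum_const_mul (r : ℝ) (v : X × X → ℝ) :
    k.edgeSum m (fun p => r * v p) = r * k.edgeSum m v := by
  rw [edgeSum, edgeSum, ← tsum_mul_left]
  exact tsum_congr fun p => by ring

/-! ### Edge sums and integration by parts. -/

namespace IsReversible

variable (hm : k.IsReversible m)
include hm

theorem conductance_nonneg (p : X × X) : 0 ≤ k.conductance m p :=
  mul_nonneg (hm.nonneg _) (k.jumpRate_nonneg _ _)

theorem conductance_swap (p : X × X) : k.conductance m p.swap = k.conductance m p := by
  obtain ⟨x, y⟩ := p
  simp only [conductance, jumpRate, Prod.fst_swap, Prod.snd_swap]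
  by_cases h : x = y
  · simp [h]
  · simp [h, Ne.symm h, hm.symm x y]

theorem summable_mul_M₁ : Summable fun x => m x * k.M₁ x := by
  refine Summable.of_nonneg_of_le (fun x => mul_nonneg (hm.nonneg x) (k.M₁_nonneg x)) (fun x => ?_)
    (hm.hasSum.summable.add hm.summable_sq)
  nlinarith [hm.nonneg x, mul_nonneg (hm.nonneg x) (sq_nonneg (k.M₁ x - 1)),
    mul_nonneg (hm.nonneg x) (sq_nonneg (k.M₁ x))]

theorem summable_conductance_mul_fst {u : X → ℝ} (hu : ∀ x, 0 ≤ u x)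
    (h : Summable fun x => m x * k.M₁ x * u x) :
    Summable fun p : X × X => k.conductance m p * u p.1 := by
  rw [summable_prod_of_nonneg fun p => mul_nonneg (hm.conductance_nonneg p) (hu _)]
  constructor
  · intro x
    exact ((k.summable_jumpRate x).mul_left (m x)).mul_right (u x)
  · convert h using 2 with x
    simp only [conductance]
    rw [tsum_mul_right, tsum_mul_left, tsum_jumpRate]

/-- The conductances out of `x` add up to `m x * M₁ x`, so a factor linear in `M₁ x` costs the
second moment of `M₁`. A factor in `M₁ y` is reduced to this by the symmetry of the conductance. -/
theorem summable_edge {v : X × X → ℝ} (hv : k.RateGrowth v) :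
    Summable fun p => k.conductance m p * v p := by
  obtain ⟨C, hC⟩ := hv
  have h₁ : Summable fun p : X × X => k.conductance m p * (1 + 2 * k.M₁ p.1) := by
    apply hm.summable_conductance_mul_fst (u := fun x => 1 + 2 * k.M₁ x)
    · intro x
      linarith [k.M₁_nonneg x]
    · refine (hm.summable_mul_M₁.add (hm.summable_sq.mul_left 2)).congr fun x => ?_
      ring
  have h₂ : Summable fun p : X × X => k.conductance m p * (1 + 2 * k.M₁ p.2) := by
    refine ((Equiv.prodComm X X).summable_iff.2 h₁).congr fun p => ?_
    simp [hm.conductance_swap p]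
  refine Summable.of_norm_bounded ((h₁.add h₂).mul_left (C / 2)) fun p => ?_
  rw [Real.norm_eq_abs, abs_mul, abs_of_nonneg (hm.conductance_nonneg p)]
  refine (mul_le_mul_of_nonneg_left (hC p) (hm.conductance_nonneg p)).trans_eq ?_
  ring

theorem edgeSum_swap (v : X × X → ℝ) :
    k.edgeSum m (fun p => v p.swap) = k.edgeSum m v := by
  rw [edgeSum, edgeSum, ← (Equiv.prodComm X X).tsum_eq]
  refine tsum_congr fun p => ?_
  simp [hm.conductance_swap p]

theorem edgeSum_add {v w : X × X → ℝ} (hv : k.RateGrowth v) (hw : k.RateGrowth w) :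
    k.edgeSum m (fun p => v p + w p) = k.edgeSum m v + k.edgeSum m w := by
  rw [edgeSum, edgeSum, edgeSum, ← (hm.summable_edge hv).tsum_add (hm.summable_edge hw)]
  exact tsum_congr fun p => by ring

theorem edgeSum_mono {v w : X × X → ℝ} (hv : k.RateGrowth v) (hw : k.RateGrowth w)
    (h : ∀ p, v p ≤ w p) : k.edgeSum m v ≤ k.edgeSum m w :=
  (hm.summable_edge hv).tsum_le_tsum
    (fun p => mul_le_mul_of_nonneg_left (h p) (hm.conductance_nonneg p)) (hm.summable_edge hw)

/-- Fubini's theorem for the edge sum. -/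
theorem hasSum_edge {v : X × X → ℝ} (hv : k.RateGrowth v) :
    HasSum (fun x => m x * ∑' y, k.jumpRate x y * v (x, y)) (k.edgeSum m v) := by
  have h := hm.summable_edge hv
  have h₂ := h.hasSum.prod_fiberwise fun x => (h.prod_factor x).hasSum
  unfold edgeSum
  convert h₂ using 2 with x
  rw [← tsum_mul_left]
  exact tsum_congr fun y => by simp [conductance, mul_assoc]

/-- Averaging the sum with its image under reversal of the edges produces the difference of `g`. -/
theorem edgeSum_fst_mul_sub {g u : X → ℝ}
    (h : k.RateGrowth fun p => g p.1 * (u p.2 - u p.1)) :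
    k.edgeSum m (fun p => g p.1 * (u p.2 - u p.1)) =
      -(k.edgeSum m fun p => (g p.2 - g p.1) * (u p.2 - u p.1)) / 2 := by
  have h' := h.swap
  have e := hm.edgeSum_swap fun p => g p.1 * (u p.2 - u p.1)
  have e₂ := hm.edgeSum_add (h.const_mul (-1)) (h'.const_mul (-1))
  rw [edgeSum_const_mul, edgeSum_const_mul, e] at e₂
  have e₃ : (k.edgeSum m fun p => (g p.2 - g p.1) * (u p.2 - u p.1)) =
    k.edgeSum m fun p => -1 * (g p.1 * (u p.2 - u p.1)) +
        -1 * (g p.swap.1 * (u p.swap.2 - u p.swap.1)) := by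
    congr 1
    ext p
    simp only [Prod.fst_swap, Prod.snd_swap]
    ring
  rw [e₃, e₂]
  ring

/-- Integration by parts. -/
theorem hasSum_mul_gen {g u : X → ℝ} (h : k.RateGrowth fun p => g p.1 * (u p.2 - u p.1)) :
    HasSum (fun x => m x * (g x * k.gen u x))
      (-(k.edgeSum m fun p => (g p.2 - g p.1) * (u p.2 - u p.1)) / 2) := by
  rw [← hm.edgeSum_fst_mul_sub h]
  convert hm.hasSum_edge h using 3 with x
  rw [gen_eq, ← tsum_mul_left]
  exact tsum_congr fun y => by ring

end IsReversible

/-! ### The resolvent equation -/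

theorem gen_eq_sub (k : MarkovRates X) {f : X → ℝ} {C : ℝ} (hf : ∀ x, |f x| ≤ C) (x : X) :
    k.gen f x = ∑' y, k.jumpRate x y * f y - k.M₁ x * f x := by
  rw [gen_eq, ← tsum_jumpRate, ← tsum_mul_right,
    ← (k.summable_jumpRate_mul x hf).tsum_sub ((k.summable_jumpRate x).mul_right (f x))]
  exact tsum_congr fun y => by ring

theorem abs_le_max_of_mem_Icc {a b r : ℝ} (h : r ∈ Set.Icc a b) : |r| ≤ max |a| |b| :=
  abs_le_max_abs_abs h.1 h.2

/-- One step of the implicit Euler scheme for the heat flow: for `h > 0` the equation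
`g - h L g = f` has a solution with the same bounds as `f`. -/
theorem exists_sub_mul_gen_eq (k : MarkovRates X) {a b h : ℝ} (h0 : 0 ≤ h) {f : X → ℝ}
    (hf : ∀ x, f x ∈ Set.Icc a b) :
    ∃ g : X → ℝ, (∀ x, g x ∈ Set.Icc a b) ∧ ∀ x, g x - h * k.gen g x = f x := by
  rcases isEmpty_or_nonempty X with hX | ⟨⟨x₀⟩⟩
  · exact ⟨f, hf, fun x => isEmptyElim x⟩
  have hab : a ≤ b := (hf x₀).1.trans (hf x₀).2
  -- This makes `Set.Icc a b`, and hence the space of functions into it, a complete lattice.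
  have : Fact (a ≤ b) := ⟨hab⟩
  have hpos : ∀ x, 0 < 1 + h * k.M₁ x := fun x => by
    have := mul_nonneg h0 (k.M₁_nonneg x)
    linarith
  have hsum : ∀ (g : X → Set.Icc a b) (x : X), Summable fun y => k.jumpRate x y * (g y : ℝ) :=
    fun g x => k.summable_jumpRate_mul x fun y => abs_le_max_of_mem_Icc (g y).2
  -- Moving the diagonal term `M₁ g` of `L g` to the left gives a fixed point equation for `g`,
  -- whose right-hand side is an average of `f x` and the values of `g`.
  have hmem : ∀ (g : X → Set.Icc a b) (x : X),
      (f x + h * ∑' y, k.jumpRate x y * (g y : ℝ)) / (1 + h * k.M₁ x) ∈ Set.Icc a b := by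
    intro g x
    have h₁ : k.M₁ x * a ≤ ∑' y, k.jumpRate x y * (g y : ℝ) := by
      rw [← tsum_jumpRate, ← tsum_mul_right]
      exact ((k.summable_jumpRate x).mul_right a).tsum_le_tsum
        (fun y => mul_le_mul_of_nonneg_left (g y).2.1 (k.jumpRate_nonneg x y)) (hsum g x)
    have h₂ : ∑' y, k.jumpRate x y * (g y : ℝ) ≤ k.M₁ x * b := by
      rw [← tsum_jumpRate, ← tsum_mul_right]
      exact (hsum g x).tsum_le_tsum
        (fun y => mul_le_mul_of_nonneg_left (g y).2.2 (k.jumpRate_nonneg x y))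
        ((k.summable_jumpRate x).mul_right b)
    have h₃ := mul_le_mul_of_nonneg_left h₁ h0
    have h₄ := mul_le_mul_of_nonneg_left h₂ h0
    constructor
    · rw [le_div_iff₀ (hpos x)]
      linarith [(hf x).1]
    · rw [div_le_iff₀ (hpos x)]
      linarith [(hf x).2]
  let T : (X → Set.Icc a b) →o (X → Set.Icc a b) :=
    { toFun := fun g x => ⟨_, hmem g x⟩
      monotone' := by
        intro g₁ g₂ hg x
        refine Subtype.mk_le_mk.2 (div_le_div_of_nonneg_right ?_ (hpos x).le)
        have : ∑' y, k.jumpRate x y * (g₁ y : ℝ) ≤ ∑' y, k.jumpRate x y * (g₂ y : ℝ) :=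
          (hsum g₁ x).tsum_le_tsum
            (fun y => mul_le_mul_of_nonneg_left (hg y) (k.jumpRate_nonneg x y)) (hsum g₂ x)
        linarith [mul_le_mul_of_nonneg_left this h0] }
  -- Knaster-Tarski suffices since `T` is monotone; with unbounded `M₁` there need not be a uniform
  -- contraction.
  obtain ⟨g, hg⟩ : ∃ g, T g = g := ⟨OrderHom.lfp T, T.map_lfp⟩
  refine ⟨fun x => g x, fun x => (g x).2, fun x => ?_⟩
  have hfix : (f x + h * ∑' y, k.jumpRate x y * (g y : ℝ)) / (1 + h * k.M₁ x) = g x :=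
    congrArg Subtype.val (congrFun hg x)
  rw [div_eq_iff (hpos x).ne'] at hfix
  rw [k.gen_eq_sub fun y => abs_le_max_of_mem_Icc (g y).2]
  linarith

/-! ### Entropy, Fisher information and Dirichlet energy of bounded functions -/

/-- The Fisher information with respect to the weights `m`. -/
def fisher (k : MarkovRates X) (m : X → ℝ) (g : X → ℝ) : ℝ :=
  k.edgeSum m (fun p => (g p.2 - g p.1) * (Real.log (g p.2) - Real.log (g p.1))) / 2

/-- The Dirichlet energy with respect to the weights `m`. -/
def energy (k : MarkovRates X) (m : X → ℝ) (g : X → ℝ) : ℝ :=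
  k.edgeSum m (fun p => (g p.2 - g p.1) * (g p.2 - g p.1)) / 2

/-- The entropy `∑ m g log g`. -/
def entropy (m : X → ℝ) (g : X → ℝ) : ℝ :=
  ∑' x, m x * (g x * Real.log (g x))

theorem _root_.HasSum.of_eq {u v : X → ℝ} {r s : ℝ} (h : HasSum u r) (hv : ∀ x, v x = u x)
    (hs : s = r) : HasSum v s := by
  rw [hs, funext hv]
  exact h

theorem log_mem_Icc {a b r : ℝ} (ha : 0 < a) (h : r ∈ Set.Icc a b) :
    Real.log r ∈ Set.Icc (Real.log a) (Real.log b) :=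
  ⟨Real.log_le_log ha h.1, Real.log_le_log (ha.trans_le h.1) h.2⟩

theorem sub_mul_log_sub_log_nonneg {r s : ℝ} (hr : 0 < r) (hs : 0 < s) :
    0 ≤ (s - r) * (Real.log s - Real.log r) := by
  rcases le_total r s with h | h
  · exact mul_nonneg (sub_nonneg.2 h) (sub_nonneg.2 (Real.log_le_log hr h))
  · exact mul_nonneg_of_nonpos_of_nonpos (sub_nonpos.2 h) (sub_nonpos.2 (Real.log_le_log hs h))

theorem log_sub_log_le {r s : ℝ} (hr : 0 < r) (hs : 0 < s) :
    Real.log s - Real.log r ≤ s / r - 1 := by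
  rw [← Real.log_div hs.ne' hr.ne']
  exact Real.log_le_sub_one_of_pos (div_pos hs hr)

/-- The tangent inequality for the convex, homogeneous function `(s - r) (log s - log r)`. -/
theorem tangent_le_sub_mul_log_sub_log {r s r' s' : ℝ} (hr : 0 < r) (hs : 0 < s) (hr' : 0 < r')
    (hs' : 0 < s') :
    (-(Real.log s - Real.log r) - (s - r) / r) * r' + (-(Real.log r - Real.log s) - (r - s) / s) * s'
      ≤ (s' - r') * (Real.log s' - Real.log r') := by
  -- By homogeneity the tangent has no constant term, and the gap is controlled by `log t ≤ t - 1`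
  -- at the cross ratio and at its inverse.
  have h₁ : (Real.log s' + Real.log r - (Real.log r' + Real.log s)) ≤ (s' * r) / (r' * s) - 1 := by
    rw [← Real.log_mul hs'.ne' hr.ne', ← Real.log_mul hr'.ne' hs.ne']
    exact log_sub_log_le (by positivity) (by positivity)
  have h₂ : (Real.log r' + Real.log s - (Real.log s' + Real.log r)) ≤ (r' * s) / (s' * r) - 1 := by
    rw [← Real.log_mul hs'.ne' hr.ne', ← Real.log_mul hr'.ne' hs.ne']
    exact log_sub_log_le (by positivity) (by positivity)
  have h₃ := mul_le_mul_of_nonneg_left h₁ hr'.le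
  have h₄ := mul_le_mul_of_nonneg_left h₂ hs'.le
  have e₁ : r' * ((s' * r) / (r' * s) - 1) = s' * (r / s) - r' := by field_simp
  have e₂ : s' * ((r' * s) / (s' * r) - 1) = r' * (s / r) - s' := by field_simp
  have e₃ : (s - r) / r = s / r - 1 := by field_simp
  have e₄ : (r - s) / s = r / s - 1 := by field_simp
  rw [e₁] at h₃
  rw [e₂] at h₄
  rw [e₃, e₄]
  linarith

/-! ### The integrated curvature condition and one step of the scheme. -/

namespace IsReversible

variable (hm : k.IsReversible m) {a b : ℝ} {f g : X → ℝ}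
include hm

theorem hasSum_gen {C : ℝ} (hg : ∀ x, |g x| ≤ C) : HasSum (fun x => m x * k.gen g x) 0 := by
  have h : k.RateGrowth fun p : X × X => (fun _ => (1 : ℝ)) p.1 * (g p.2 - g p.1) :=
    rateGrowth_of_bounded (C := 2 * C) fun p => by
      simpa using abs_sub_le_of_bounded hg p.1 p.2
  exact (hm.hasSum_mul_gen (g := fun _ => 1) h).of_eq (fun x => by ring) (by simp [edgeSum])

theorem summable_mul_of_bounded {C : ℝ} (hg : ∀ x, |g x| ≤ C) : Summable fun x => m x * g x := by
  refine Summable.of_norm_bounded (hm.hasSum.summable.mul_right C) fun x => ?_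
  rw [Real.norm_eq_abs, abs_mul, abs_of_nonneg (hm.nonneg x)]
  exact mul_le_mul_of_nonneg_left (hg x) (hm.nonneg x)

omit hm in
theorem rateGrowth_mul_sub {u : X → ℝ} {C : ℝ} (hg : ∀ x, |g x| ≤ C) (hu : k.PointGrowth u) :
    k.RateGrowth fun p => g p.1 * (u p.2 - u p.1) :=
  (hu.snd.sub hu.fst).bounded_mul fun p => hg p.1

omit hm in
theorem rateGrowth_mul_sub' {u : X → ℝ} {C : ℝ} (hg : ∀ x, |g x| ≤ C) (hu : k.PointGrowth u) :
    k.RateGrowth fun p => u p.1 * (g p.2 - g p.1) := by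
  simpa only [mul_comm] using
    hu.fst.bounded_mul (w := fun p => g p.2 - g p.1) fun p => abs_sub_le_of_bounded hg p.1 p.2

/-- The generator is symmetric on bounded functions paired with functions of linear growth. -/
theorem hasSum_gen_symm {u : X → ℝ} {C : ℝ} (hg : ∀ x, |g x| ≤ C) (hu : k.PointGrowth u) :
    HasSum (fun x => m x * (g x * k.gen u x)) (∑' x, m x * (u x * k.gen g x)) ∧
      HasSum (fun x => m x * (u x * k.gen g x)) (∑' x, m x * (u x * k.gen g x)) ∧
      (k.edgeSum m fun p => (g p.2 - g p.1) * (u p.2 - u p.1)) =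
        -2 * ∑' x, m x * (u x * k.gen g x) := by
  have h₁ := hm.hasSum_mul_gen (rateGrowth_mul_sub hg hu)
  have h₂ := hm.hasSum_mul_gen (rateGrowth_mul_sub' hg hu)
  have e : (k.edgeSum m fun p => (u p.2 - u p.1) * (g p.2 - g p.1)) =
      k.edgeSum m fun p => (g p.2 - g p.1) * (u p.2 - u p.1) := by
    simp only [mul_comm]
  rw [e] at h₂
  rw [h₂.tsum_eq]
  exact ⟨h₁, h₂, by ring⟩

section Positive

variable (ha : 0 < a) (hg : ∀ x, g x ∈ Set.Icc a b)
include ha hg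

omit hm in
theorem abs_log_le (x : X) : |Real.log (g x)| ≤ max |Real.log a| |Real.log b| :=
  abs_le_max_of_mem_Icc (log_mem_Icc ha (hg x))

omit hm in
theorem pos_of_mem (x : X) : 0 < g x := ha.trans_le (hg x).1

omit hm in
theorem rateGrowth_fisher :
    k.RateGrowth fun p => (g p.2 - g p.1) * (Real.log (g p.2) - Real.log (g p.1)) :=
  RateGrowth.bounded_mul (fun _ => abs_sub_le_of_bounded (fun x => abs_le_max_of_mem_Icc (hg x)) _ _)
    (rateGrowth_of_bounded fun p => abs_sub_le_of_bounded (abs_log_le ha hg) p.1 p.2)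

theorem fisher_nonneg : 0 ≤ k.fisher m g := by
  refine div_nonneg (tsum_nonneg fun p => mul_nonneg (hm.conductance_nonneg p) ?_) zero_le_two
  exact sub_mul_log_sub_log_nonneg (pos_of_mem ha hg _) (pos_of_mem ha hg _)

theorem hasSum_mul_gen_log :
    HasSum (fun x => m x * (g x * k.gen (fun x => Real.log (g x)) x)) (-k.fisher m g) := by
  have := hm.hasSum_mul_gen (rateGrowth_mul_sub (fun x => abs_le_max_of_mem_Icc (hg x))
    (pointGrowth_of_bounded (k := k) (abs_log_le ha hg)))
  rwa [neg_div] at this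

theorem hasSum_log_mul_gen :
    HasSum (fun x => m x * (Real.log (g x) * k.gen g x)) (-k.fisher m g) := by
  obtain ⟨h₁, h₂, -⟩ := hm.hasSum_gen_symm (fun x => abs_le_max_of_mem_Icc (hg x))
    (pointGrowth_of_bounded (k := k) (abs_log_le ha hg))
  rw [← (hm.hasSum_mul_gen_log ha hg).unique h₁] at h₂
  exact h₂

omit hm in
theorem exp_log_sub_log (x y : X) :
    Real.exp (Real.log (g y) - Real.log (g x)) = g y / g x := by
  rw [Real.exp_sub, Real.exp_log (pos_of_mem ha hg y), Real.exp_log (pos_of_mem ha hg x)]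

omit hm in
-- A discrete chain rule, from `exp (log g(y) - log g(x)) = g(y)/g(x)`. Multiplied by `m g` and
-- summed it shows that `Ψ_Υ(log g)` has integral `I(g)`, because `L g` has integral zero.
theorem Psi_Upsilon_log (x : X) :
    k.Psi Upsilon (fun x => Real.log (g x)) x =
      k.gen g x / g x - k.gen (fun x => Real.log (g x)) x := by
  rw [Psi_eq k (by simp [Upsilon]), gen_eq, gen_eq, div_eq_mul_inv, ← tsum_mul_right,
    ← Summable.tsum_sub]
  · refine tsum_congr fun y => ?_
    have := (pos_of_mem ha hg x).ne'
    rw [Upsilon, exp_log_sub_log ha hg]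
    field_simp
    ring
  · exact (k.summable_jumpRate_mul x
      (abs_sub_le_of_bounded (fun x => abs_le_max_of_mem_Icc (hg x)) x)).mul_right _
  · exact k.summable_jumpRate_mul x (abs_sub_le_of_bounded (abs_log_le ha hg) x)

omit hm in
theorem pointGrowth_Psi : k.PointGrowth (k.Psi Upsilon fun x => Real.log (g x)) := by
  set C := max |Real.log a| |Real.log b|
  refine pointGrowth_of_le_M₁ (C := Real.exp (2 * C) + 2 * C + 1) fun x => ?_
  rw [Psi_eq k (by simp [Upsilon])]
  refine k.abs_tsum_jumpRate_mul_le x fun y => ?_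
  have h := abs_le.1 (abs_sub_le_of_bounded (abs_log_le ha hg) x y)
  have h₁ := Real.exp_le_exp.2 h.2
  have h₂ := Real.exp_pos (Real.log (g y) - Real.log (g x))
  rw [Upsilon, abs_le]
  constructor <;> linarith [h.1, h.2]

omit hm in
-- Since `Υ'(log g(y) - log g(x)) = g(y)/g(x) - 1`, the factor `g x` clears the denominator and
-- leaves an expression symmetric in `x` and `y`.
theorem mul_B_log (x : X) (u : X → ℝ) :
    g x * k.B (deriv Upsilon) (fun x => Real.log (g x)) u x =
      ∑' y, k.jumpRate x y * ((g y - g x) * (u y - u x)) := by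
  have hd : deriv Upsilon = fun r => Real.exp r - 1 := by
    ext r
    exact (((Real.hasDerivAt_exp r).sub (hasDerivAt_id r)).sub_const 1).deriv
  rw [B_eq, ← tsum_mul_left]
  refine tsum_congr fun y => ?_
  have := (pos_of_mem ha hg x).ne'
  simp only [hd]
  rw [exp_log_sub_log ha hg]
  field_simp

/-- The sum of `g Ψ₂(log g)`. -/
theorem hasSum_mul_Psi₂_log :
    HasSum (fun x => m x * (g x * k.Psi₂ Upsilon (fun x => Real.log (g x)) x))
      ((∑' x, m x * (k.Psi Upsilon (fun x => Real.log (g x)) x * k.gen g x)) / 2 +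
        ∑' x, m x * (k.gen (fun x => Real.log (g x)) x * k.gen g x)) := by
  have hb : ∀ x, |g x| ≤ _ := fun x => abs_le_max_of_mem_Icc (hg x)
  have hL := pointGrowth_gen (k := k) (abs_log_le ha hg)
  obtain ⟨h₁, -, -⟩ := hm.hasSum_gen_symm hb (pointGrowth_Psi (k := k) ha hg)
  obtain ⟨-, -, h₂⟩ := hm.hasSum_gen_symm hb hL
  have h₃ := hm.hasSum_edge (RateGrowth.bounded_mul
    (fun p : X × X => abs_sub_le_of_bounded hb p.1 p.2) (hL.snd.sub hL.fst))
  rw [h₂] at h₃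
  refine ((h₁.sub h₃).div_const 2).of_eq (fun x => ?_) (by ring)
  simp only
  rw [← mul_B_log ha hg, Psi₂]
  ring

/-- The curvature-dimension inequality integrated against `g`. -/
theorem fisher_le_of_CDUpsilon {κ n : ℝ} (hn : 0 < n) (hCD : k.CDUpsilon κ n)
    (h1 : HasSum (fun x => m x * g x) 1) :
    2 * κ * k.fisher m g + 2 * k.fisher m g ^ 2 / n ≤
      (∑' x, m x * (k.Psi Upsilon (fun x => Real.log (g x)) x * k.gen g x)) +
        2 * ∑' x, m x * (k.gen (fun x => Real.log (g x)) x * k.gen g x) := by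
  have hI := hm.fisher_nonneg ha hg
  set I := k.fisher m g
  set w := fun x => Real.log (g x) with hw
  have h₀ := hm.hasSum_mul_gen_log ha hg
  have h₁ := hm.hasSum_mul_Psi₂_log ha hg
  have h₂ : HasSum (fun x => m x * (g x * k.Psi Upsilon w x)) I := by
    refine ((hm.hasSum_gen fun x => abs_le_max_of_mem_Icc (hg x)).sub h₀).of_eq (fun x => ?_)
      (by simp [I])
    have := (pos_of_mem ha hg x).ne'
    rw [Psi_Upsilon_log ha hg]
    field_simp
  -- Jensen for the square under the probability weights `m g`, via the tangent of `r²` at the mean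
  -- `I` of `-L log g`.
  have h₃ := ((h₂.mul_left κ).add ((h₀.mul_left (-2 * I)).sub (h1.mul_left (I ^ 2)) |>.div_const n))
  have h₄ := hasSum_le (fun x => ?_) h₃ h₁
  · have e : κ * I + (-2 * I * -k.fisher m g - I ^ 2 * 1) / n = κ * I + I ^ 2 / n := by
      simp only [I]
      ring
    rw [e] at h₄
    have e₂ : 2 * κ * I + 2 * I ^ 2 / n = 2 * (κ * I + I ^ 2 / n) := by ring
    rw [e₂]
    linarith
  · have hc := hCD w ⟨_, abs_log_le ha hg⟩ x
    -- As `I ≥ 0`, the tangent is nonpositive on the negative half-line, so it also lies below the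
    -- extension by zero.
    have ht : (-2 * I * k.gen w x - I ^ 2) / n ≤
        trivialExtension (fun r => r ^ 2 / n) (-k.gen w x) := by
      unfold trivialExtension
      split_ifs with h
      · refine div_le_div_of_nonneg_right ?_ hn.le
        nlinarith [sq_nonneg (k.gen w x + I)]
      · push Not at h
        refine div_nonpos_of_nonpos_of_nonneg ?_ hn.le
        nlinarith [mul_nonneg hI (by linarith : 0 ≤ k.gen w x)]
    have := mul_le_mul_of_nonneg_left (hc.le.trans' (add_le_add_right ht _))
      (mul_nonneg (hm.nonneg x) (pos_of_mem ha hg x).le)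
    refine le_trans (le_of_eq ?_) (this.trans_eq (by ring))
    ring

end Positive

/-- The growth of the Fisher information against the implicit heat flow. -/
theorem fisher_step {κ n h : ℝ} (ha : 0 < a) (hf : ∀ x, f x ∈ Set.Icc a b)
    (hg : ∀ x, g x ∈ Set.Icc a b) (hn : 0 < n) (hh : 0 ≤ h) (hCD : k.CDUpsilon κ n)
    (h1 : HasSum (fun x => m x * g x) 1) (hfg : ∀ x, g x - h * k.gen g x = f x) :
    k.fisher m g + h * (2 * κ * k.fisher m g + 2 * k.fisher m g ^ 2 / n) ≤ k.fisher m f := by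
  have hcd := mul_le_mul_of_nonneg_left (hm.fisher_le_of_CDUpsilon ha hg hn hCD h1) hh
  have h₀ := hm.hasSum_mul_gen_log ha hg
  have hgen := hm.hasSum_gen fun x => abs_le_max_of_mem_Icc (hg x)
  obtain ⟨-, h₂, -⟩ := hm.hasSum_gen_symm (fun x => abs_le_max_of_mem_Icc (hg x))
    (pointGrowth_Psi (k := k) ha hg)
  obtain ⟨-, h₃, -⟩ := hm.hasSum_gen_symm (fun x => abs_le_max_of_mem_Icc (hg x))
    (pointGrowth_gen (k := k) (abs_log_le ha hg))
  set w := fun x => Real.log (g x) with hw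
  have hgp := fun x => pos_of_mem ha hg x
  -- Half of the tangent at `g`, evaluated at `f`; the other half is its reflection.
  set A : X × X → ℝ := fun p =>
    (-(Real.log (g p.2) - Real.log (g p.1)) - (g p.2 - g p.1) / g p.1) * f p.1 with hA
  have hAg : k.RateGrowth A := by
    have hbd : k.RateGrowth fun p : X × X =>
        -1 * (Real.log (g p.2) - Real.log (g p.1)) - (g p.1)⁻¹ * (g p.2 - g p.1) := by
      refine ((rateGrowth_of_bounded fun p : X × X =>
        abs_sub_le_of_bounded (abs_log_le ha hg) p.1 p.2).const_mul (-1)).sub ?_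
      refine RateGrowth.bounded_mul (C := a⁻¹) (fun p => ?_) (rateGrowth_of_bounded fun p : X × X =>
        abs_sub_le_of_bounded (fun x => abs_le_max_of_mem_Icc (hg x)) p.1 p.2)
      rw [abs_of_pos (inv_pos.2 (hgp _))]
      exact inv_anti₀ ha (hg _).1
    convert hbd.bounded_mul (fun p : X × X => abs_le_max_of_mem_Icc (hf p.1)) using 2 with p
    simp only [hA]
    ring
  have hAsum : HasSum (fun x => m x * (f x * (-k.gen w x - k.gen g x / g x))) (k.edgeSum m A) := by
    convert hm.hasSum_edge hAg using 2 with x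
    congr 1
    have s₁ := k.summable_jumpRate_mul x (abs_sub_le_of_bounded (abs_log_le ha hg) x)
    have s₂ := k.summable_jumpRate_mul x
      (abs_sub_le_of_bounded (fun x => abs_le_max_of_mem_Icc (hg x)) x)
    have := ((s₁.hasSum.mul_left (-1)).sub (s₂.hasSum.mul_right (g x)⁻¹)).mul_right (f x)
    rw [gen_eq, gen_eq]
    refine Eq.trans ?_ (this.tsum_eq.symm.trans (tsum_congr fun y => ?_))
    · ring
    · simp only [hA]
      ring
  have hle : 2 * k.edgeSum m A ≤ 2 * k.fisher m f := by
    have e := hm.edgeSum_add hAg hAg.swap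
    rw [hm.edgeSum_swap A] at e
    have := hm.edgeSum_mono (hAg.add hAg.swap) (rateGrowth_fisher ha hf)
      fun p => tangent_le_sub_mul_log_sub_log (hgp p.1) (hgp p.2)
        (pos_of_mem ha hf p.1) (pos_of_mem ha hf p.2)
    rw [e] at this
    have e' : 2 * k.fisher m f = k.edgeSum m
        (fun p => (f p.2 - f p.1) * (Real.log (f p.2) - Real.log (f p.1))) := by
      rw [fisher]
      ring
    rw [e']
    linarith
  -- Substituting `f = g - h L g` and `L g / g = Ψ_Υ(w) + L w` gives `I(g)` plus `h` times the
  -- right-hand side of the integrated curvature condition.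
  have hA' : HasSum (fun x => m x * (f x * (-k.gen w x - k.gen g x / g x))) _ :=
    ((h₀.neg.sub hgen).add ((h₂.mul_left h).add (h₃.mul_left (2 * h)))).of_eq (fun x => by
      rw [Psi_Upsilon_log ha hg, ← hfg x]
      have := (hgp x).ne'
      field_simp
      ring) rfl
  have := hAsum.unique hA'
  linarith

/-- The decay of the Dirichlet energy along the implicit heat flow. -/
theorem energy_step {h C : ℝ} (hg : ∀ x, |g x| ≤ C) (hf : ∀ x, |f x| ≤ C)
    (hfg : ∀ x, g x - h * k.gen g x = f x) :
    k.energy m g + 2 * h * ∑' x, m x * (k.gen g x * k.gen g x) ≤ k.energy m f := by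
  have hL := pointGrowth_gen (k := k) hg
  obtain ⟨-, -, h₂⟩ := hm.hasSum_gen_symm hg hL
  have r₁ : ∀ {u : X → ℝ}, (∀ x, |u x| ≤ C) →
      k.RateGrowth fun p : X × X => (u p.2 - u p.1) * (u p.2 - u p.1) := fun hu =>
    RateGrowth.bounded_mul (fun p : X × X => abs_sub_le_of_bounded hu p.1 p.2)
      (rateGrowth_of_bounded fun p : X × X => abs_sub_le_of_bounded hu p.1 p.2)
  have r₂ := (RateGrowth.bounded_mul
    (fun p : X × X => abs_sub_le_of_bounded hg p.1 p.2) (hL.snd.sub hL.fst)).const_mul (-2 * h)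
  -- Expand the square of the increment of `f = g - h L g` and drop the term in `h²`.
  have := hm.edgeSum_mono ((r₁ hg).add r₂) (r₁ hf) fun p => by
    rw [← hfg p.1, ← hfg p.2]
    nlinarith [sq_nonneg (h * (k.gen g p.2 - k.gen g p.1))]
  rw [hm.edgeSum_add (r₁ hg) r₂, edgeSum_const_mul, h₂] at this
  unfold energy
  linarith

theorem energy_nonneg (g : X → ℝ) : 0 ≤ k.energy m g :=
  div_nonneg (tsum_nonneg fun p => mul_nonneg (hm.conductance_nonneg p) (mul_self_nonneg _))
    zero_le_two

theorem hasSum_entropy (ha : 0 < a) (hg : ∀ x, g x ∈ Set.Icc a b) :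
    HasSum (fun x => m x * (g x * Real.log (g x))) (entropy m g) := by
  refine (hm.summable_mul_of_bounded
    (C := max |a| |b| * max |Real.log a| |Real.log b|) fun x => ?_).hasSum
  rw [abs_mul]
  exact mul_le_mul (abs_le_max_of_mem_Icc (hg x)) (abs_log_le ha hg x) (abs_nonneg _)
    ((abs_nonneg _).trans (le_max_left _ _))

/-- The decay of the entropy along the implicit heat flow. -/
theorem entropy_step {h : ℝ} (ha : 0 < a) (hf : ∀ x, f x ∈ Set.Icc a b)
    (hg : ∀ x, g x ∈ Set.Icc a b) (hfg : ∀ x, g x - h * k.gen g x = f x) :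
    entropy m f - entropy m g ≤
      h * k.fisher m g + h ^ 2 / a * ∑' x, m x * (k.gen g x * k.gen g x) := by
  have hb : ∀ x, |g x| ≤ _ := fun x => abs_le_max_of_mem_Icc (hg x)
  obtain ⟨h₂, -⟩ := (hm.hasSum_gen_symm hb (pointGrowth_gen (k := k) hb)).2
  have hR := (((hm.hasSum_log_mul_gen ha hg).mul_left (-h)).add
    ((hm.hasSum_gen hb).mul_left (-h))).add (h₂.mul_left (h ^ 2 / a))
  have := hasSum_le (fun x => ?_) ((hm.hasSum_entropy ha hf).sub (hm.hasSum_entropy ha hg)) hR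
  · linarith
  · have hfp := pos_of_mem ha hf x
    have hgp := pos_of_mem ha hg x
    have t₁ := mul_le_mul_of_nonneg_left (log_sub_log_le hgp hfp) hgp.le
    have e₁ : g x * (f x / g x - 1) = f x - g x := by field_simp
    rw [e₁] at t₁
    have t₂ : (f x - g x) * (Real.log (f x) - Real.log (g x)) ≤ (f x - g x) ^ 2 / a := by
      rcases le_total (g x) (f x) with hle | hle
      · have := (log_sub_log_le hgp hfp).trans (b := f x / g x - 1) (c := (f x - g x) / a) ?_
        · refine (mul_le_mul_of_nonneg_left this (sub_nonneg.2 hle)).trans_eq (by ring)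
        · rw [div_sub_one hgp.ne']
          exact div_le_div_of_nonneg_left (sub_nonneg.2 hle) ha (hg x).1
      · have := (log_sub_log_le hfp hgp).trans (b := g x / f x - 1) (c := (g x - f x) / a) ?_
        · have := mul_le_mul_of_nonneg_left this (sub_nonneg.2 hle)
          have e : (g x - f x) * ((g x - f x) / a) = (f x - g x) ^ 2 / a := by ring
          linarith
        · rw [div_sub_one hfp.ne']
          exact div_le_div_of_nonneg_left (sub_nonneg.2 hle) ha (hf x).1
    have e₂ : f x - g x = -h * k.gen g x := by linarith [hfg x]
    -- The remainder of the linearisation at `g` is `g (log f - log g) + (f - g)(log f - log g)`,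
    -- bounded by `t₁` and `t₂`.
    have key : f x * Real.log (f x) - g x * Real.log (g x) ≤
        Real.log (g x) * (f x - g x) + (f x - g x) + (f x - g x) ^ 2 / a := by
      linarith
    rw [e₂] at key
    refine le_trans (le_of_eq ?_) ((mul_le_mul_of_nonneg_left key (hm.nonneg x)).trans_eq ?_)
    · ring
    · ring

end IsReversible

/-! ### The entropy-information inequality for bounded densities -/

open Filter Topology

/-- The slope of `log` on `[a, b]` is at least `1 / b`. -/
theorem sq_sub_le_mul_log {a b r s : ℝ} (ha : 0 < a) (hr : r ∈ Set.Icc a b)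
    (hs : s ∈ Set.Icc a b) :
    (s - r) ^ 2 ≤ b * ((s - r) * (Real.log s - Real.log r)) := by
  wlog h : r ≤ s generalizing r s
  · have := this hs hr (le_of_not_ge h)
    linarith
  have hr0 := ha.trans_le hr.1
  have hs0 := ha.trans_le hs.1
  have h₁ := mul_le_mul_of_nonneg_left (log_sub_log_le hs0 hr0) hs0.le
  have e : s * (r / s - 1) = r - s := by field_simp
  rw [e] at h₁
  have h₂ := mul_le_mul_of_nonneg_right hs.2 (sub_nonneg.2 (Real.log_le_log hr0 h))
  nlinarith [mul_le_mul_of_nonneg_left (show s - r ≤ b * (Real.log s - Real.log r) by linarith)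
    (sub_nonneg.2 h)]

/-- The comparison of one step of the scheme with the differential inequality for the Fisher
information. -/
theorem mul_le_log_sub_log {κ n h r s R : ℝ} (hκ : 0 < κ) (hn : 0 < n) (hh : 0 ≤ h) (hr : 0 ≤ r)
    (hR : r ≤ R) (hrs : r + h * (2 * κ * r + 2 * r ^ 2 / n) ≤ s) :
    h * r ≤ (1 + 2 * h * R / n) *
      (n / 2 * Real.log (1 + s / (κ * n)) - n / 2 * Real.log (1 + r / (κ * n))) := by
  set t := 2 * h * r / n with ht
  have ht0 : 0 ≤ t := by positivity
  have hκn := mul_pos hκ hn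
  -- The quadratic in `hrs` factorises: one step shrinks `1 + I/(κn)` by at least the factor `1 +
  -- t`.
  have h₁ : (1 + r / (κ * n)) * (1 + t) ≤ 1 + s / (κ * n) := by
    have e : (1 + r / (κ * n)) * (1 + t) =
        1 + (r + h * (2 * κ * r + 2 * r ^ 2 / n)) / (κ * n) := by
      rw [ht]
      field_simp
      ring
    rw [e]
    exact add_le_add_right (div_le_div_of_nonneg_right hrs hκn.le) 1
  have hp : 0 < 1 + r / (κ * n) := by positivity
  have h₂ := Real.log_le_log (mul_pos hp (by linarith)) h₁
  rw [Real.log_mul hp.ne' (by linarith)] at h₂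
  have h₃ := log_sub_log_le (r := 1 + t) (s := 1) (by linarith) one_pos
  rw [Real.log_one] at h₃
  have h₄ := mul_le_mul_of_nonneg_left h₃ (show 0 ≤ 1 + t by linarith)
  have e₄ : (1 + t) * (1 / (1 + t) - 1) = -t := by
    have : 1 + t ≠ 0 := by linarith
    field_simp
    ring
  rw [e₄] at h₄
  have hlog : 0 ≤ Real.log (1 + t) := Real.log_nonneg (by linarith)
  have htR : t ≤ 2 * h * R / n :=
    div_le_div_of_nonneg_right (mul_le_mul_of_nonneg_left hR (by linarith)) hn.le
  -- From `t ≤ (1 + t) log (1 + t)`; the prefactor is the price of discretisation and tends to one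
  -- with `h → 0`.
  have h₅ : t ≤ (1 + 2 * h * R / n) * Real.log (1 + t) := by
    nlinarith [mul_le_mul_of_nonneg_right htR hlog]
  have h₆ : h * r = n / 2 * t := by
    rw [ht]
    field_simp
  rw [h₆, ← mul_sub, mul_left_comm]
  refine mul_le_mul_of_nonneg_left (h₅.trans (mul_le_mul_of_nonneg_left (by linarith) ?_))
    (by linarith)
  linarith

/-! ### Convergence to equilibrium and summation of the steps. -/

namespace IsReversible

variable (hm : k.IsReversible m) {a b : ℝ} {f g : X → ℝ}
include hm

theorem pos (hirr : k.Irreducible) (x : X) : 0 < m x := by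
  obtain ⟨x₀, h₀⟩ : ∃ x₀, 0 < m x₀ := by
    by_contra! h
    have : m = fun _ => 0 := funext fun x => (h x).antisymm (hm.nonneg x)
    have h1 := hm.hasSum
    rw [this] at h1
    exact zero_ne_one (hasSum_zero.unique h1)
  induction hirr x₀ x with
  | refl => exact h₀
  | @tail y z _ hyz ih =>
    have h := hm.symm y z
    have hp := mul_pos ih hyz.2
    rw [h] at hp
    exact (hm.nonneg z).lt_of_ne fun e => by simp [← e] at hp

/-- Each edge of positive conductance is a single nonnegative summand of the Fisher information, so
the increments along it vanish; irreducibility chains such edges. -/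
theorem tendsto_sub_of_fisher (hirr : k.Irreducible) (ha : 0 < a) {F : ℕ → X → ℝ}
    (hF : ∀ j x, F j x ∈ Set.Icc a b)
    (hI : Tendsto (fun j => k.fisher m (F j)) atTop (𝓝 0)) (x y : X) :
    Tendsto (fun j => F j y - F j x) atTop (𝓝 0) := by
  induction hirr x y with
  | refl => simp
  | @tail y z _ hyz ih =>
    suffices h : Tendsto (fun j => F j z - F j y) atTop (𝓝 0) by
      simpa using h.add ih
    have hc : 0 < k.conductance m (y, z) := by
      simpa [conductance, jumpRate, hyz.1] using mul_pos (hm.pos hirr y) hyz.2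
    have hb : 0 < b := ha.trans_le ((hF 0 x).1.trans (hF 0 x).2)
    have hle : ∀ j, (F j z - F j y) ^ 2 ≤ b * (2 * k.fisher m (F j) / k.conductance m (y, z)) := by
      intro j
      refine (sq_sub_le_mul_log ha (hF j y) (hF j z)).trans (mul_le_mul_of_nonneg_left ?_ hb.le)
      rw [le_div_iff₀ hc, mul_comm]
      have := (hm.summable_edge (rateGrowth_fisher ha (hF j))).le_tsum (y, z) fun p _ =>
        mul_nonneg (hm.conductance_nonneg p)
          (sub_mul_log_sub_log_nonneg (pos_of_mem ha (hF j) p.1) (pos_of_mem ha (hF j) p.2))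
      refine this.trans_eq ?_
      rw [fisher, edgeSum]
      ring
    have hlim : Tendsto (fun j => b * (2 * k.fisher m (F j) / k.conductance m (y, z))) atTop
        (𝓝 0) := by
      simpa using ((hI.const_mul 2).div_const (k.conductance m (y, z))).const_mul b
    have hsq := squeeze_zero (fun j => sq_nonneg _) hle hlim
    have := (Real.continuous_sqrt.tendsto 0).comp hsq
    simp only [Function.comp_def, Real.sqrt_zero, Real.sqrt_sq_eq_abs] at this
    exact (tendsto_zero_iff_abs_tendsto_zero _).2 this

theorem tendsto_tsum_of_bounded {F : ℕ → X → ℝ} {u : X → ℝ} {C : ℝ} (hF : ∀ j x, |F j x| ≤ C)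
    (h : ∀ x, Tendsto (fun j => F j x) atTop (𝓝 (u x))) :
    Tendsto (fun j => ∑' x, m x * F j x) atTop (𝓝 (∑' x, m x * u x)) := by
  refine tendsto_tsum_of_dominated_convergence (hm.hasSum.summable.mul_right C)
    (fun x => (h x).const_mul (m x)) (Eventually.of_forall fun j x => ?_)
  rw [Real.norm_eq_abs, abs_mul, abs_of_nonneg (hm.nonneg x)]
  exact mul_le_mul_of_nonneg_left (hF j x) (hm.nonneg x)

/-- Densities with vanishing Fisher information converge to equilibrium in entropy. -/
theorem tendsto_entropy_of_fisher (hirr : k.Irreducible) (ha : 0 < a) {F : ℕ → X → ℝ}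
    (hF : ∀ j x, F j x ∈ Set.Icc a b) (h1 : ∀ j, HasSum (fun x => m x * F j x) 1)
    (hI : Tendsto (fun j => k.fisher m (F j)) atTop (𝓝 0)) :
    Tendsto (fun j => entropy m (F j)) atTop (𝓝 0) := by
  have hd := hm.tendsto_sub_of_fisher hirr ha hF hI
  have hb : ∀ j x, |F j x| ≤ _ := fun j x => abs_le_max_of_mem_Icc (hF j x)
  have hlim : ∀ x, Tendsto (fun j => F j x) atTop (𝓝 1) := by
    intro x
    -- Averaging the differences over `y` gives `1 - F j x`, since each `F j` has mass one.
    have h := hm.tendsto_tsum_of_bounded (fun j => abs_sub_le_of_bounded (hb j) x) (hd x)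
    have e : ∀ j, ∑' y, m y * (F j y - F j x) = 1 - F j x := fun j =>
      (((h1 j).sub (hm.hasSum.mul_right (F j x))).of_eq (fun y => by ring) (by ring)).tsum_eq
    simp only [e, mul_zero, tsum_zero] at h
    simpa using h.const_sub 1
  have h := hm.tendsto_tsum_of_bounded (F := fun j x => F j x * Real.log (F j x))
    (u := fun _ => 1 * Real.log 1)
    (C := max |a| |b| * max |Real.log a| |Real.log b|) (fun j x => ?_) fun x =>
      (hlim x).mul ((Real.continuousAt_log one_ne_zero).tendsto.comp (hlim x))
  · simpa [entropy] using h
  · rw [abs_mul]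
    exact mul_le_mul (hb j x) (abs_log_le ha (hF j) x) (abs_nonneg _)
      ((abs_nonneg _).trans (le_max_left _ _))

/-- Iterating the Euler step, each loss of entropy is at most the decrease of `R Φ(I) + h/(2a) E`,
with `E` the Dirichlet energy. The sum telescopes, and the entropy tends to zero. -/
theorem entropy_le_add {κ n h : ℝ} (hirr : k.Irreducible) (hκ : 0 < κ) (hn : 0 < n)
    (hCD : k.CDUpsilon κ n) (ha : 0 < a) (hf : ∀ x, f x ∈ Set.Icc a b)
    (h1 : HasSum (fun x => m x * f x) 1) (hh : 0 < h) :
    entropy m f ≤ (1 + 2 * h * k.fisher m f / n) *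
      (n / 2 * Real.log (1 + k.fisher m f / (κ * n))) + h / (2 * a) * k.energy m f := by
  have hex : ∀ u : {u : X → ℝ // ∀ x, u x ∈ Set.Icc a b},
      ∃ v : {v : X → ℝ // ∀ x, v x ∈ Set.Icc a b}, ∀ x, v.1 x - h * k.gen v.1 x = u.1 x := by
    intro u
    obtain ⟨v, hv, e⟩ := k.exists_sub_mul_gen_eq hh.le u.2
    exact ⟨⟨v, hv⟩, e⟩
  choose S hS using hex
  let F : ℕ → X → ℝ := fun j => (S^[j] ⟨f, hf⟩).1
  have hF : ∀ j x, F j x ∈ Set.Icc a b := fun j => (S^[j] ⟨f, hf⟩).2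
  have hb : ∀ j x, |F j x| ≤ _ := fun j x => abs_le_max_of_mem_Icc (hF j x)
  have hstep : ∀ j x, F (j + 1) x - h * k.gen (F (j + 1)) x = F j x := by
    intro j x
    simp only [F, Function.iterate_succ_apply']
    exact hS _ x
  have hF1 : ∀ j, HasSum (fun x => m x * F j x) 1 := by
    intro j
    induction j with
    | zero => exact h1
    | succ j ih =>
      refine (ih.add ((hm.hasSum_gen (hb (j + 1))).mul_left h)).of_eq (fun x => ?_) (by ring)
      rw [← hstep j x]
      ring
  have hI0 : ∀ j, 0 ≤ k.fisher m (F j) := fun j => hm.fisher_nonneg ha (hF j)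
  have hI : ∀ j, k.fisher m (F (j + 1)) +
      h * (2 * κ * k.fisher m (F (j + 1)) + 2 * k.fisher m (F (j + 1)) ^ 2 / n) ≤
        k.fisher m (F j) := fun j =>
    hm.fisher_step ha (hF j) (hF (j + 1)) hn hh.le hCD (hF1 (j + 1)) (hstep j)
  have hanti : Antitone fun j => k.fisher m (F j) := by
    refine antitone_nat_of_succ_le fun j => le_trans ?_ (hI j)
    have := hI0 (j + 1)
    have : 0 ≤ h * (2 * κ * k.fisher m (F (j + 1)) + 2 * k.fisher m (F (j + 1)) ^ 2 / n) := by
      positivity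
    linarith
  set R := 1 + 2 * h * k.fisher m f / n with hR
  set Φ : ℝ → ℝ := fun s => n / 2 * Real.log (1 + s / (κ * n)) with hΦ
  have hR0 : 0 ≤ R := by
    have := hI0 0
    change 0 ≤ k.fisher m f at this
    positivity
  have hH : ∀ j, entropy m (F j) - entropy m (F (j + 1)) ≤
      (R * Φ (k.fisher m (F j)) + h / (2 * a) * k.energy m (F j)) -
        (R * Φ (k.fisher m (F (j + 1))) + h / (2 * a) * k.energy m (F (j + 1))) := by
    intro j
    have t₁ := hm.entropy_step ha (hF j) (hF (j + 1)) (hstep j)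
    have t₂ := mul_le_mul_of_nonneg_left (hm.energy_step (hb (j + 1)) (hb j) (hstep j))
      (show 0 ≤ h / (2 * a) by positivity)
    have t₃ := mul_le_log_sub_log hκ hn hh.le (hI0 (j + 1)) (hanti (Nat.zero_le (j + 1))) (hI j)
    have e : ∀ D : ℝ, h / (2 * a) * (k.energy m (F (j + 1)) + 2 * h * D) =
        h / (2 * a) * k.energy m (F (j + 1)) + h ^ 2 / a * D := fun D => by
      field_simp
    rw [e] at t₂
    have e₃ : (fun j => k.fisher m (F j)) 0 = k.fisher m f := rfl
    rw [e₃, ← hR, mul_sub] at t₃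
    simp only [hΦ]
    linarith
  have hΦ0 : ∀ j, 0 ≤ Φ (k.fisher m (F j)) := fun j => by
    have := div_nonneg (hI0 j) (mul_pos hκ hn).le
    exact mul_nonneg (by linarith) (Real.log_nonneg (by linarith))
  have hN : ∀ N, entropy m f - entropy m (F N) ≤
      R * Φ (k.fisher m f) + h / (2 * a) * k.energy m f := by
    intro N
    have ht := Finset.sum_le_sum fun j (_ : j ∈ Finset.range N) => hH j
    rw [Finset.sum_range_sub' (fun j => entropy m (F j)),
      Finset.sum_range_sub' fun j => R * Φ (k.fisher m (F j)) + h / (2 * a) * k.energy m (F j)] at ht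
    have t₁ := mul_nonneg hR0 (hΦ0 N)
    have t₂ := mul_nonneg (show 0 ≤ h / (2 * a) by positivity) (hm.energy_nonneg (F N))
    have ht' : entropy m f - entropy m (F N) ≤ _ := ht
    refine ht'.trans ?_
    change R * Φ (k.fisher m f) + h / (2 * a) * k.energy m f - _ ≤ _
    linarith
  -- The linear term `2κI` alone gives geometric decay.
  have hlim : Tendsto (fun j => k.fisher m (F j)) atTop (𝓝 0) := by
    set q := (1 + 2 * h * κ)⁻¹ with hq
    have hq0 : 0 < 1 + 2 * h * κ := by positivity
    have hgeo : ∀ j, k.fisher m (F j) ≤ k.fisher m f * q ^ j := by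
      intro j
      induction j with
      | zero => simp [F]
      | succ j ih =>
        have t : k.fisher m (F (j + 1)) * (1 + 2 * h * κ) ≤ k.fisher m (F j) := by
          have : 0 ≤ h * (2 * k.fisher m (F (j + 1)) ^ 2 / n) := by positivity
          linarith [hI j]
        rw [← le_div_iff₀ hq0, div_eq_mul_inv] at t
        refine t.trans ((mul_le_mul_of_nonneg_right ih (inv_pos.2 hq0).le).trans_eq ?_)
        rw [pow_succ, mul_assoc]
    refine squeeze_zero hI0 hgeo ?_
    have : q < 1 := inv_lt_one_of_one_lt₀ (by nlinarith [mul_pos hh hκ])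
    have t := (tendsto_pow_atTop_nhds_zero_of_lt_one (inv_pos.2 hq0).le this).const_mul
      (k.fisher m f)
    rwa [mul_zero] at t
  have hfin := (hm.tendsto_entropy_of_fisher hirr ha hF hF1 hlim).const_sub (entropy m f)
  rw [sub_zero] at hfin
  exact le_of_tendsto' hfin hN

/-- The entropy-information inequality for bounded densities. -/
theorem entropy_le {κ n : ℝ} (hirr : k.Irreducible) (hκ : 0 < κ) (hn : 0 < n)
    (hCD : k.CDUpsilon κ n) (ha : 0 < a) (hf : ∀ x, f x ∈ Set.Icc a b)
    (h1 : HasSum (fun x => m x * f x) 1) :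
    entropy m f ≤ n / 2 * Real.log (1 + k.fisher m f / (κ * n)) := by
  have hlim : Tendsto (fun h : ℝ => (1 + 2 * h * k.fisher m f / n) *
      (n / 2 * Real.log (1 + k.fisher m f / (κ * n))) + h / (2 * a) * k.energy m f) (𝓝[>] 0)
      (𝓝 ((1 + 2 * 0 * k.fisher m f / n) *
      (n / 2 * Real.log (1 + k.fisher m f / (κ * n))) + 0 / (2 * a) * k.energy m f)) := by
    refine tendsto_nhdsWithin_of_tendsto_nhds (Continuous.tendsto ?_ 0)
    fun_prop
  have := ge_of_tendsto hlim (eventually_nhdsWithin_of_forall fun h hh =>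
    hm.entropy_le_add hirr hκ hn hCD ha hf h1 hh)
  simpa using this

end IsReversible

/-! ### The Nash inequality -/

/-- The truncation of `r` to the interval `[a, b]`. -/
def clamp (a b r : ℝ) : ℝ := max a (min r b)

theorem clamp_mem_Icc {a b : ℝ} (hab : a ≤ b) (r : ℝ) : clamp a b r ∈ Set.Icc a b :=
  ⟨le_max_left _ _, max_le hab (min_le_right _ _)⟩

theorem clamp_eq_self {a b r : ℝ} (h : r ∈ Set.Icc a b) : clamp a b r = r := by
  rw [clamp, min_eq_left h.2, max_eq_right h.1]

theorem clamp_le_clamp (a b : ℝ) {r s : ℝ} (h : r ≤ s) : clamp a b r ≤ clamp a b s :=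
  max_le_max le_rfl (min_le_min h le_rfl)

theorem clamp_sub_clamp_le (a b : ℝ) {r s : ℝ} (h : r ≤ s) :
    clamp a b s - clamp a b r ≤ s - r := by
  unfold clamp
  grind

theorem log_clamp {a b r : ℝ} (ha : 0 < a) (hb : 0 < b) (hr : 0 < r) :
    Real.log (clamp a b r) = clamp (Real.log a) (Real.log b) (Real.log r) := by
  have hmono := Real.strictMonoOn_log.monotoneOn
  rw [clamp, hmono.map_max ha (lt_min hr hb : 0 < min r b), hmono.map_min hr hb, clamp]

/-- Truncation is monotone and 1-Lipschitz, and `log` carries it to a truncation at the logarithms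
of the levels, so both factors shrink in absolute value and keep a common sign. -/
theorem clamp_sub_mul_log_le {a b r s : ℝ} (ha : 0 < a) (hb : 0 < b) (hr : 0 < r) (hs : 0 < s) :
    (clamp a b s - clamp a b r) * (Real.log (clamp a b s) - Real.log (clamp a b r)) ≤
      (s - r) * (Real.log s - Real.log r) := by
  wlog h : r ≤ s generalizing r s
  · have := this hs hr (le_of_not_ge h)
    linarith
  rw [log_clamp ha hb hr, log_clamp ha hb hs]
  have hl := Real.log_le_log hr h
  exact mul_le_mul (clamp_sub_clamp_le a b h) (clamp_sub_clamp_le _ _ hl)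
    (sub_nonneg.2 (clamp_le_clamp _ _ hl)) (sub_nonneg.2 h)

theorem fisher_const_mul {g : X → ℝ} (hg : ∀ x, 0 < g x) {c : ℝ} (hc : 0 < c) :
    k.fisher m (fun x => c * g x) = c * k.fisher m g := by
  rw [fisher, fisher, ← mul_div_assoc, ← edgeSum_const_mul]
  congr 2
  ext p
  rw [Real.log_mul hc.ne' (hg _).ne', Real.log_mul hc.ne' (hg _).ne']
  ring

namespace IsReversible

variable (hm : k.IsReversible m) {a b κ n : ℝ} {g : X → ℝ}
include hm

/-- Jensen's inequality for the entropy of a density. -/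
theorem log_sub_log_le_entropy (ha : 0 < a) (hg : ∀ x, g x ∈ Set.Icc a b) {N₁ N₂ : ℝ}
    (h₁ : HasSum (fun x => m x * √(g x)) N₁) (h₂ : HasSum (fun x => m x * g x) N₂)
    (hN₁ : 0 < N₁) (hN₂ : 0 < N₂) :
    N₂ * (2 * Real.log N₂ - 2 * Real.log N₁) ≤ entropy m g := by
  have hl := ((h₂.mul_left (2 * Real.log N₂ - 2 * Real.log N₁ + 2)).sub
    (h₁.mul_left (2 * (N₂ / N₁))))
  have := hasSum_le (fun x => ?_) hl (hm.hasSum_entropy ha hg)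
  · refine le_trans (le_of_eq ?_) this
    field_simp
    ring
  · have hgp := pos_of_mem ha hg x
    have hs := Real.sqrt_pos.2 hgp
    -- The constant `N₂ / N₁` is the mean of `1 / √g` under the probability weights `m g / N₂`,
    -- which makes the integrated tangent bound sharp.
    have hlog := log_sub_log_le hs (div_pos hN₂ hN₁)
    rw [Real.log_div hN₂.ne' hN₁.ne', Real.log_sqrt hgp.le] at hlog
    have := mul_le_mul_of_nonneg_left hlog (mul_nonneg (hm.nonneg x) hgp.le)
    have e : m x * g x * (N₂ / N₁ / √(g x) - 1) = (N₂ / N₁) * (m x * √(g x)) - m x * g x := by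
      have e' : g x / √(g x) = √(g x) := Real.div_sqrt
      calc m x * g x * (N₂ / N₁ / √(g x) - 1) =
          (N₂ / N₁) * (m x * (g x / √(g x))) - m x * g x := by ring
        _ = _ := by rw [e']
    rw [e] at this
    linarith

theorem hasSum_pos (ha : 0 < a) (hg : ∀ x, a ≤ g x) {N : ℝ}
    (h : HasSum (fun x => m x * g x) N) : 0 < N := by
  refine ha.trans_le ?_
  have := hasSum_le (fun x => ?_) (hm.hasSum.mul_right a) h
  · linarith
  · exact mul_le_mul_of_nonneg_left (hg x) (hm.nonneg x)

/-- The Nash inequality for densities bounded from above and below. -/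
theorem nash_of_bounded (hirr : k.Irreducible) (hκ : 0 < κ) (hn : 0 < n)
    (hCD : k.CDUpsilon κ n) (ha : 0 < a) (hg : ∀ x, g x ∈ Set.Icc a b) {N₁ N₂ : ℝ}
    (h₁ : HasSum (fun x => m x * √(g x)) N₁) (h₂ : HasSum (fun x => m x * g x) N₂) :
    N₂ ^ ((n + 2) / 2) ≤ (N₂ + k.fisher m g / (κ * n)) ^ (n / 2) * N₁ ^ 2 := by
  have hN₂ := hm.hasSum_pos ha (fun x => (hg x).1) h₂
  have hN₁ := hm.hasSum_pos (Real.sqrt_pos.2 ha) (fun x => Real.sqrt_le_sqrt (hg x).1) h₁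
  have hI := hm.fisher_nonneg ha hg
  have hκn := mul_pos hκ hn
  -- The entropy bound requires mass one; `N₁` then scales by `√c` and the Fisher information by
  -- `c`.
  set c := N₂⁻¹ with hc
  have hc0 : 0 < c := inv_pos.2 hN₂
  have hcg : ∀ x, c * g x ∈ Set.Icc (c * a) (c * b) := fun x =>
    ⟨mul_le_mul_of_nonneg_left (hg x).1 hc0.le, mul_le_mul_of_nonneg_left (hg x).2 hc0.le⟩
  have hc₁ : HasSum (fun x => m x * √(c * g x)) (√c * N₁) :=
    (h₁.mul_left (√c)).of_eq (fun x => by rw [Real.sqrt_mul hc0.le]; ring) rfl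
  have hc₂ : HasSum (fun x => m x * (c * g x)) 1 :=
    (h₂.mul_left c).of_eq (fun x => by ring) (inv_mul_cancel₀ hN₂.ne').symm
  have t₁ := hm.log_sub_log_le_entropy (mul_pos hc0 ha) hcg hc₁ hc₂
    (mul_pos (Real.sqrt_pos.2 hc0) hN₁) one_pos
  have t₂ := hm.entropy_le hirr hκ hn hCD (mul_pos hc0 ha) hcg hc₂
  rw [fisher_const_mul (fun x => pos_of_mem ha hg x) hc0] at t₂
  rw [Real.log_one, Real.log_mul (Real.sqrt_pos.2 hc0).ne' hN₁.ne', Real.log_sqrt hc0.le, hc,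
    Real.log_inv] at t₁
  have e : N₂ + k.fisher m g / (κ * n) = N₂ * (1 + N₂⁻¹ * k.fisher m g / (κ * n)) := by
    field_simp
  have hp : 0 < 1 + N₂⁻¹ * k.fisher m g / (κ * n) := by positivity
  have hp' : 0 < N₂ + k.fisher m g / (κ * n) := by positivity
  have hlog : Real.log (N₂ ^ ((n + 2) / 2)) ≤
      Real.log ((N₂ + k.fisher m g / (κ * n)) ^ (n / 2) * N₁ ^ 2) := by
    rw [Real.log_mul (Real.rpow_pos_of_pos hp' _).ne' (pow_pos hN₁ 2).ne', Real.log_rpow hN₂,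
      Real.log_rpow hp', Real.log_pow, e, Real.log_mul hN₂.ne' hp.ne']
    push_cast
    linarith
  exact (Real.log_le_log_iff (Real.rpow_pos_of_pos hN₂ _)
    (mul_pos (Real.rpow_pos_of_pos hp' _) (pow_pos hN₁ 2))).1 hlog

/-- The Nash inequality for summable positive densities, in terms of a bound for the Fisher
information of the truncated densities. -/
theorem nash (hirr : k.Irreducible) (hκ : 0 < κ) (hn : 0 < n)
    (hCD : k.CDUpsilon κ n) (hg : ∀ x, 0 < g x) {N₁ N₂ J : ℝ}
    (h₁ : HasSum (fun x => m x * √(g x)) N₁) (h₂ : HasSum (fun x => m x * g x) N₂)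
    (hJ : ∀ a b : ℝ, 0 < a → a ≤ b → k.fisher m (fun x => clamp a b (g x)) ≤ J) :
    N₂ ^ ((n + 2) / 2) ≤ (N₂ + J / (κ * n)) ^ (n / 2) * N₁ ^ 2 := by
  -- At each point the truncation is eventually inactive. The lower level is at most one, which
  -- yields the majorant `g + 1`.
  let T : ℕ → X → ℝ := fun j x => clamp ((j : ℝ) + 1)⁻¹ (j + 1) (g x)
  have hj : ∀ j : ℕ, (0 : ℝ) < ((j : ℝ) + 1)⁻¹ := fun j => by positivity
  have hj1 : ∀ j : ℕ, ((j : ℝ) + 1)⁻¹ ≤ 1 := fun j =>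
    inv_le_one_of_one_le₀ (by linarith [(Nat.cast_nonneg j : (0 : ℝ) ≤ j)])
  have hjj : ∀ j : ℕ, ((j : ℝ) + 1)⁻¹ ≤ j + 1 := fun j =>
    (hj1 j).trans (by linarith [(Nat.cast_nonneg j : (0 : ℝ) ≤ j)])
  have hT : ∀ (j : ℕ) x, T j x ∈ Set.Icc ((j : ℝ) + 1)⁻¹ (j + 1) := fun j x => clamp_mem_Icc (hjj j) _
  have hT0 : ∀ j x, 0 < T j x := fun j x => (hj j).trans_le (hT j x).1
  have hTle : ∀ j x, T j x ≤ g x + 1 := fun j x =>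
    max_le (by linarith [hj1 j, hg x]) ((min_le_left _ _).trans (by linarith))
  have hlim : ∀ x, Tendsto (fun j => T j x) atTop (𝓝 (g x)) := by
    intro x
    refine tendsto_const_nhds.congr' ?_
    have hup : Tendsto (fun j : ℕ => (j : ℝ) + 1) atTop atTop :=
      tendsto_natCast_atTop_atTop.atTop_add tendsto_const_nhds
    filter_upwards [hup.eventually_ge_atTop (g x), hup.eventually_ge_atTop (g x)⁻¹] with j h₁ h₂
    exact (clamp_eq_self ⟨inv_le_of_inv_le₀ (hg x) h₂, h₁⟩).symm
  have hs₂ : Summable fun x => m x * (g x + 1) :=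
    (h₂.summable.add hm.hasSum.summable).congr fun x => by ring
  have hs₁ : Summable fun x => m x * (g x + 2) :=
    (hs₂.add hm.hasSum.summable).congr fun x => by ring
  have hsq : ∀ j x, √(T j x) ≤ g x + 2 := fun j x => by
    have := Real.sq_sqrt (hT0 j x).le
    nlinarith [hTle j x, sq_nonneg (√(T j x) - 1), Real.sqrt_nonneg (T j x)]
  have sum₂ : ∀ j, Summable fun x => m x * T j x := fun j =>
    hs₂.of_nonneg_of_le (fun x => mul_nonneg (hm.nonneg x) (hT0 j x).le)
      fun x => mul_le_mul_of_nonneg_left (hTle j x) (hm.nonneg x)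
  have sum₁ : ∀ j, Summable fun x => m x * √(T j x) := fun j =>
    hs₁.of_nonneg_of_le (fun x => mul_nonneg (hm.nonneg x) (Real.sqrt_nonneg _))
      fun x => mul_le_mul_of_nonneg_left (hsq j x) (hm.nonneg x)
  have lim₂ : Tendsto (fun j => ∑' x, m x * T j x) atTop (𝓝 N₂) := by
    rw [← h₂.tsum_eq]
    refine tendsto_tsum_of_dominated_convergence hs₂ (fun x => (hlim x).const_mul _)
      (Eventually.of_forall fun j x => ?_)
    rw [Real.norm_of_nonneg (mul_nonneg (hm.nonneg x) (hT0 j x).le)]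
    exact mul_le_mul_of_nonneg_left (hTle j x) (hm.nonneg x)
  have lim₁ : Tendsto (fun j => ∑' x, m x * √(T j x)) atTop (𝓝 N₁) := by
    rw [← h₁.tsum_eq]
    refine tendsto_tsum_of_dominated_convergence hs₁
      (fun x => ((Real.continuous_sqrt.tendsto _).comp (hlim x)).const_mul _)
      (Eventually.of_forall fun j x => ?_)
    rw [Real.norm_of_nonneg (mul_nonneg (hm.nonneg x) (Real.sqrt_nonneg _))]
    exact mul_le_mul_of_nonneg_left (hsq j x) (hm.nonneg x)
  have hκn := mul_pos hκ hn
  refine le_of_tendsto_of_tendsto' (lim₂.rpow_const (Or.inr (by positivity)))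
    (((lim₂.add_const (J / (κ * n))).rpow_const (Or.inr (by positivity))).mul (lim₁.pow 2))
    fun j => ?_
  refine (hm.nash_of_bounded hirr hκ hn hCD (hj j) (hT j) (sum₁ j).hasSum
    (sum₂ j).hasSum).trans (mul_le_mul_of_nonneg_right ?_ (sq_nonneg _))
  have hI := hm.fisher_nonneg (hj j) (hT j)
  have h0 : 0 ≤ ∑' x, m x * T j x := tsum_nonneg fun x => mul_nonneg (hm.nonneg x) (hT0 j x).le
  refine Real.rpow_le_rpow (by positivity) ?_ (by positivity)
  exact add_le_add_right (div_le_div_of_nonneg_right (hJ _ _ (hj j) (hjj j)) hκn.le) _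

end IsReversible

/-! ### Transfer to measures -/

section Measure

variable [MeasurableSpace X] {μ : Measure X}

/-- An edgewise comparison, providing the bound `J` of `nash` uniformly in the truncation levels. -/
theorem ofReal_fisher_clamp_le (hm : k.IsReversible fun x => μ.real {x}) {g : X → ℝ}
    (hg : ∀ x, 0 < g x) {a b : ℝ} (ha : 0 < a) (hab : a ≤ b) :
    ENNReal.ofReal (k.fisher (fun x => μ.real {x}) fun x => clamp a b (g x)) ≤
      k.fisherInformation μ g := by
  have hc : ∀ x, clamp a b (g x) ∈ Set.Icc a b := fun x => clamp_mem_Icc hab _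
  have hs := hm.summable_edge (IsReversible.rateGrowth_fisher ha hc)
  rw [fisher, edgeSum, div_eq_inv_mul, ENNReal.ofReal_mul (by positivity),
    ENNReal.ofReal_inv_of_pos two_pos, ENNReal.ofReal_ofNat, fisherInformation,
    ENNReal.ofReal_tsum_of_nonneg _ hs, ENNReal.tsum_prod']
  · refine mul_le_mul_right (ENNReal.tsum_le_tsum fun x => ENNReal.tsum_le_tsum fun y =>
      ENNReal.ofReal_le_ofReal ?_) _
    refine (mul_le_mul_of_nonneg_left (clamp_sub_mul_log_le ha (ha.trans_le hab) (hg x) (hg y))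
      (hm.conductance_nonneg (x, y))).trans_eq ?_
    rw [mul_assoc (k.rate x y), k.rate_mul_eq_jumpRate_mul fun h => by simp [h], conductance]
    ring
  · exact fun p => mul_nonneg (hm.conductance_nonneg p) (sub_mul_log_sub_log_nonneg
      (IsReversible.pos_of_mem ha hc p.1) (IsReversible.pos_of_mem ha hc p.2))

variable [Countable X] [MeasurableSingletonClass X]

theorem hasSum_measureReal_mul {u : X → ℝ} (hu : Integrable u μ) :
    HasSum (fun x => μ.real {x} * u x) (∫ x, u x ∂μ) := by
  have h : Integrable u (Measure.sum fun x => μ {x} • Measure.dirac x) := by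
    rwa [Measure.sum_smul_dirac]
  have := hasSum_integral_measure h
  rw [Measure.sum_smul_dirac] at this
  simpa [Measure.real] using this

theorem isReversible_measureReal [IsProbabilityMeasure μ] (hμ : k.DetailedBalance μ)
    (hM : MemLp k.M₁ 2 μ) : k.IsReversible fun x => μ.real {x} where
  nonneg x := measureReal_nonneg
  hasSum := by
    simpa using hasSum_measureReal_mul (integrable_const (μ := μ) (1 : ℝ))
  symm := hμ
  summable_sq := (hasSum_measureReal_mul hM.integrable_sq).summable

end Measure

end

end MarkovRates

theorem mainTheorem9 {X : Type*} [Countable X] [MeasurableSpace X] [MeasurableSingletonClass X]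
    (k : MarkovRates X) (hirr : k.Irreducible)
    (μ : Measure X) [IsProbabilityMeasure μ] (hμ : k.DetailedBalance μ)
    (hM₁ : MemLp k.M₁ 2 μ) (hM₂ : MemLp k.M₂ 1 μ) (hrec : k.PositiveRecurrent)
    {κ n : ℝ} (hκ : 0 < κ) (hn : 0 < n) (hCD : k.CDUpsilon κ n)
    (f : X → ℝ) (hf : MemLp f 2 μ) (hf₀ : ∀ x, f x ≠ 0) :
    eLpNorm f 2 μ ^ (n + 2) ≤
      (eLpNorm f 2 μ ^ 2 + k.fisherInformation μ (fun x => f x ^ 2) / ENNReal.ofReal (κ * n))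
          ^ (n / 2) *
        eLpNorm f 1 μ ^ 2 := by
  have hf1 : MemLp f 1 μ := hf.mono_exponent (by norm_num)
  have hκn := mul_pos hκ hn
  -- In `ℝ≥0∞` one has `∞ * 0 = 0`, so this case needs `‖f‖₁ ≠ 0`, which holds as `f` has no zeros.
  by_cases htop : k.fisherInformation μ (fun x => f x ^ 2) = ∞
  · have hne : eLpNorm f 1 μ ≠ 0 := by
      rw [Ne, eLpNorm_eq_zero_iff hf1.1 one_ne_zero]
      intro h
      obtain ⟨x, hx⟩ := h.exists
      exact hf₀ x hx
    rw [htop, ENNReal.top_div_of_ne_top ENNReal.ofReal_ne_top, add_top,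
      ENNReal.top_rpow_of_pos (by positivity), ENNReal.top_mul (pow_ne_zero 2 hne)]
    exact le_top
  have hm := MarkovRates.isReversible_measureReal hμ hM₁
  have hg : ∀ x, 0 < f x ^ 2 := fun x => by have := hf₀ x; positivity
  set J := (k.fisherInformation μ fun x => f x ^ 2).toReal with hJ
  set N₁ := ∫ x, |f x| ∂μ with hN₁
  set N₂ := ∫ x, f x ^ 2 ∂μ with hN₂
  have h₁ : HasSum (fun x => μ.real {x} * √(f x ^ 2)) N₁ := by
    simpa [Real.sqrt_sq_eq_abs] using
      MarkovRates.hasSum_measureReal_mul (memLp_one_iff_integrable.1 hf1).abs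
  have h₂ : HasSum (fun x => μ.real {x} * f x ^ 2) N₂ :=
    MarkovRates.hasSum_measureReal_mul hf.integrable_sq
  -- The density is `g = f²`, so that `√g = |f|` produces the `ℓ¹` norm.
  have key := hm.nash hirr hκ hn hCD hg h₁ h₂ fun a b ha hab =>
    (ENNReal.ofReal_le_iff_le_toReal htop).1 (MarkovRates.ofReal_fisher_clamp_le hm hg ha hab)
  have hN₂0 : 0 ≤ N₂ := integral_nonneg fun x => sq_nonneg _
  have hN₁0 : 0 ≤ N₁ := integral_nonneg fun x => abs_nonneg _
  have e₁ : eLpNorm f 1 μ = ENNReal.ofReal N₁ := by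
    rw [hf1.eLpNorm_eq_integral_rpow_norm one_ne_zero ENNReal.one_ne_top]
    simp [hN₁]
  have e₂ : eLpNorm f 2 μ = ENNReal.ofReal (N₂ ^ (2⁻¹ : ℝ)) := by
    rw [hf.eLpNorm_eq_integral_rpow_norm two_ne_zero ENNReal.ofNat_ne_top]
    simp [hN₂]
  have e₃ : eLpNorm f 2 μ ^ (n + 2) = ENNReal.ofReal (N₂ ^ ((n + 2) / 2)) := by
    rw [e₂, ENNReal.ofReal_rpow_of_nonneg (by positivity) (by positivity), ← Real.rpow_mul hN₂0]
    congr 2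
    ring
  have e₄ : eLpNorm f 2 μ ^ 2 = ENNReal.ofReal N₂ := by
    rw [e₂, ← ENNReal.ofReal_pow (by positivity), ← Real.rpow_natCast, ← Real.rpow_mul hN₂0]
    norm_num
  have e₅ : k.fisherInformation μ (fun x => f x ^ 2) / ENNReal.ofReal (κ * n) =
      ENNReal.ofReal (J / (κ * n)) := by
    rw [ENNReal.ofReal_div_of_pos hκn, hJ, ENNReal.ofReal_toReal htop]
  have hJ0 : 0 ≤ J := ENNReal.toReal_nonneg
  rw [e₃, e₄, e₅, e₁, ← ENNReal.ofReal_add hN₂0 (by positivity),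
    ENNReal.ofReal_rpow_of_nonneg (by positivity) (by positivity), ← ENNReal.ofReal_pow hN₁0,
    ← ENNReal.ofReal_mul (by positivity)]
  exact ENNReal.ofReal_le_ofReal key
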